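/- Let $p>1$, $p'=\frac{p}{p-1}$, $\theta\in(0,1)$. Let $D\in C^1(0,1)$ with $D>0$ in $(0,1)$ (possibly singular or degenerate at $0$ and $1$), let $h\in C[0,1]$, $H(u)=\int_0^u h(s)\,ds$, $h_m=\min_{[0,1]}h$, and let $g\in C[0,1]$ satisfy $g=0$ on $[0,\theta]$, $g>0$ on $(\theta,1)$, $g(1)=0$. Assume $\int_0^1 D^{p'-1}(u)g(u)\,du<+\infty$. Put $$k(p)=\begin{cases}\dfrac{1}{2^{p'-1}-1}, & 1<p<2,\\[2mm] 1, & p=2,\\[1mm] \dfrac{p'}{p'-1+\hat k}, & p>2,\end{cases}\qquad \hat k=\frac{1+p'(p'-1)^{\frac1{p'-2}}+(p'-1)^{\frac{p'}{p'-2}}}{\bigl(1+(p'-1)^{\frac1{p'-2}}\bigr)^{p'}} .$$ For $c\in\mathbb R$ consider the problem $$\bigl(D(u)|u'|^{p-2}u'\bigr)'+(c+h(u))u'+g(u)=0,\qquad u(-\infty)=1,\quad u(+\infty)=0. \tag{P}$$ A solution of (P) is a continuous function $u:\mathbb R\to[0,1]$ such that, with $I_u=\{\xi: 0<u(\xi)<1\}$: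 (a) $u\in C^1(I_u)$ and the equation holds at every point of $I_u$; (b) the flux $\xi\mapsto D(u(\xi))|u'(\xi)|^{p-2}u'(\xi)$ (understood as $0$ where $u(\xi)\in\{0,1\}$) is continuous on $\mathbb R$ and tends to $0$ as $u(\xi)\to0$ and as $u(\xi)\to1$; (c) $u(\xi)\to1$ as $\xi\to-\infty$ and $u(\xi)\to0$ as $\xi\to+\infty$. Theorem. If $$H(1)\le h_m+\Bigl(k(p)\int_0^1D^{p'-1}(u)g(u)\,du\Bigr)^{1/p'},$$ then there is exactly one $c=c^*>-h_m$ for which (P) has a solution; for $c=c^*$ the solution is unique up to translation and is strictly decreasing on $I_u$; and $$c^*<\frac1\theta\Bigl[\Bigl(p'\int_0^1D^{p'-1}(u)g(u)\,du\Bigr)^{1/p'}-H(\theta)\Bigr].$$ -/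

import Mathlib

open Set Filter Topology MeasureTheory

namespace CombustionWave

noncomputable section


/-- The flux function `H(u) = ∫₀ᵘ h(s) ds` with convective velocity `h`. -/
def fluxH (h : ℝ → ℝ) (u : ℝ) : ℝ := ∫ s in (0 : ℝ)..u, h s

/-- `h_m`, the minimum of `h` over `[0,1]` (attained when `h` is continuous there). -/
def hMin (h : ℝ → ℝ) : ℝ := sInf (h '' Icc 0 1)

/-- The function `f = D^(p'-1) g`. -/
def weight (p : ℝ) (D g : ℝ → ℝ) (u : ℝ) : ℝ := D u ^ (Real.conjExponent p - 1) * g u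

/-- The constant `k(p)`, with `p' = p / (p - 1)` the conjugate exponent. -/
def kConst (p : ℝ) : ℝ :=
  if p < 2 then 1 / ((2 : ℝ) ^ (Real.conjExponent p - 1) - 1)
  else if p = 2 then 1
  else
    Real.conjExponent p /
      (Real.conjExponent p - 1 +
        (1 + Real.conjExponent p * (Real.conjExponent p - 1) ^ (1 / (Real.conjExponent p - 2))
            + (Real.conjExponent p - 1) ^ (Real.conjExponent p / (Real.conjExponent p - 2))) /
          (1 + (Real.conjExponent p - 1) ^ (1 / (Real.conjExponent p - 2))) ^ Real.conjExponent p)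

/-- The set `I_u` of points where `0 < u < 1`. -/
def interiorSet (u : ℝ → ℝ) : Set ℝ := {ξ | 0 < u ξ ∧ u ξ < 1}

open Classical in
/-- The diffusive flux `D(u) |u'|^(p-2) u'`.  The coefficient `D` need not be defined at `0` and
`1`, and `u'` need not exist where `u` reaches these values; there the flux is given the value
`0`, which is its limit as `u → 0` and `u → 1` for the solutions defined below. -/
def diffFlux (p : ℝ) (D u : ℝ → ℝ) (ξ : ℝ) : ℝ :=
  if ξ ∈ interiorSet u then D (u ξ) * (|deriv u ξ| ^ (p - 2) * deriv u ξ) else 0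

/-- `u` is a solution, with speed `c`, of
`(D(u)|u'|^(p-2)u')' + (c + h(u)) u' + g(u) = 0`, `u(-∞) = 1`, `u(+∞) = 0`. -/
structure IsSolution (p : ℝ) (D h g : ℝ → ℝ) (c : ℝ) (u : ℝ → ℝ) : Prop where
  continuous : Continuous u
  mem_Icc : ∀ ξ, u ξ ∈ Icc (0 : ℝ) 1
  contDiffOn : ContDiffOn ℝ 1 u (interiorSet u)
  flux_differentiableAt : ∀ ξ ∈ interiorSet u, DifferentiableAt ℝ (diffFlux p D u) ξ
  equation : ∀ ξ ∈ interiorSet u,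
    deriv (diffFlux p D u) ξ + (c + h (u ξ)) * deriv u ξ + g (u ξ) = 0
  flux_continuous : Continuous (diffFlux p D u)
  /-- the flux tends to `0` as `u(ξ) → 0` -/
  flux_tendsto_zero : Tendsto (diffFlux p D u) (comap u (𝓝 0)) (𝓝 0)
  /-- the flux tends to `0` as `u(ξ) → 1` -/
  flux_tendsto_one : Tendsto (diffFlux p D u) (comap u (𝓝 1)) (𝓝 0)
  tendsto_atBot : Tendsto u atBot (𝓝 1)
  tendsto_atTop : Tendsto u atTop (𝓝 0)

end

end CombustionWave

open CombustionWave

namespace CombustionWave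

/-! ### First and last crossing times -/

/-! Write `q` for the conjugate exponent, `f = D^(q-1) g`, `I = ∫₀¹ f` and `K(v) = c v + H(v)`. A
wave with `c > -h_m` is strictly decreasing where `0 < u < 1`, so the density can serve as
coordinate. Minus the flux then becomes a profile `W(v)` with `W' = c + h - f / W^(q-1)`, `W > 0`
inside and `W(0) = W(1) = 0`. Conversely a profile gives a wave by inverting `X' = -(D/W)^(q-1)`.
Everything reduces to this first-order problem (`IsProfile.exists_isSolution`,
`IsSolution.exists_isProfile`).

Existence is by shooting in `c`. With `y = W^q` the equation is `y' = q((c+h) y^((q-1)/q) - f)`,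
whose right side is nondecreasing in `y` when `c ≥ -h_m`. Hence the problem with `y(1) = 0` is
stable backwards, and its solution `y_c` depends continuously on `c` (`exists_phaseSol`). On `[0,θ]`
the reaction vanishes and a profile must equal `K`, so `c` is admissible once `y_c(θ) = K(θ)^q`. At
`c = -h_m` the left side is larger: otherwise integration over `[θ,1]` gives `q I ≤ (H(1) - h_m)^q`,
excluded by the hypothesis because `k(p) < q`. For large `c` it is smaller, since `y_c(θ) ≤ q I`.
The strict form `y_c(θ) < q I` at the crossing is the upper bound on the speed (`exists_isProfile`).

For uniqueness, two profiles with different speeds are already ordered at `θ`, and the equation does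
not let the gap close before `1` (`IsProfile.speed_le`). For equal speeds the squared difference is
nondecreasing and vanishes at `1` (`IsProfile.eqOn`). Equal profiles give inverse waves differing by
a constant, that is, a translation. -/

lemma exists_first_nonpos {f : ℝ → ℝ} {a b : ℝ} (hab : a ≤ b) (hf : ContinuousOn f (Icc a b))
    (ha : 0 < f a) (hb : f b ≤ 0) : ∃ x ∈ Ioc a b, f x = 0 ∧ ∀ y ∈ Ico a x, 0 < f y := by
  have hc : IsCompact (Icc a b ∩ f ⁻¹' Iic 0) :=
    isCompact_Icc.of_isClosed_subset (hf.preimage_isClosed_of_isClosed isClosed_Icc isClosed_Iic)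
      inter_subset_left
  obtain ⟨x, ⟨hx, hfx⟩, hmin⟩ := hc.exists_isLeast ⟨b, right_mem_Icc.2 hab, hb⟩
  have hax : a < x := lt_of_le_of_ne hx.1 (by rintro rfl; exact absurd hfx (not_le.2 ha))
  have hpos : ∀ y ∈ Ico a x, 0 < f y := fun y hy => by
    by_contra h
    exact absurd (hmin ⟨⟨hy.1, hy.2.le.trans hx.2⟩, not_lt.1 h⟩) (not_le.2 hy.2)
  refine ⟨x, ⟨hax, hx.2⟩, le_antisymm hfx ?_, hpos⟩
  have hcl : x ∈ closure (Ico a x) := by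
    rw [closure_Ico hax.ne]; exact right_mem_Icc.2 hax.le
  have : NeBot (𝓝[Ico a x] x) := mem_closure_iff_nhdsWithin_neBot.1 hcl
  exact ge_of_tendsto ((hf x hx).mono fun y hy => ⟨hy.1, hy.2.le.trans hx.2⟩)
    (eventually_nhdsWithin_of_forall fun y hy => (hpos y hy).le)

lemma exists_last_nonpos {f : ℝ → ℝ} {a b : ℝ} (hab : a ≤ b) (hf : ContinuousOn f (Icc a b))
    (ha : f a ≤ 0) (hb : 0 < f b) : ∃ x ∈ Ico a b, f x = 0 ∧ ∀ y ∈ Ioc x b, 0 < f y := by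
  obtain ⟨x, hx, hfx, hpos⟩ := exists_first_nonpos (f := fun x => f (-x)) (neg_le_neg hab)
    (hf.comp continuousOn_neg fun y hy => ⟨by linarith [hy.2], by linarith [hy.1]⟩)
    (by simpa using hb) (by simpa using ha)
  refine ⟨-x, ⟨by linarith [hx.2], by linarith [hx.1]⟩, hfx, fun y hy => ?_⟩
  simpa using hpos (-y) ⟨by linarith [hy.2], by linarith [hy.1]⟩

/-! ### Backward comparison -/

/-- As long as `d` exceeds the line `η (β - y)` it is positive, so `d - η (β - y)` is nondecreasing
there and cannot descend to its first zero. With `η = 0` this is the sign argument behind backward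
uniqueness. -/
lemma le_of_backward {d d' : ℝ → ℝ} {η α β : ℝ} (hη : 0 ≤ η) (hd : ContinuousOn d (Icc α β))
    (hd' : ∀ x ∈ Ioo α β, HasDerivAt d (d' x) x) (h0 : d β ≤ 0)
    (h : ∀ x ∈ Ioo α β, 0 < d x → -η ≤ d' x) {x : ℝ} (hx : x ∈ Icc α β) :
    d x ≤ η * (β - x) := by
  by_contra hlt
  have hsub : Icc x β ⊆ Icc α β := Icc_subset_Icc_left hx.1
  have hcont : ContinuousOn (fun y => d y - η * (β - y)) (Icc x β) :=
    (hd.mono hsub).sub (by fun_prop)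
  obtain ⟨z, hz, hz0, hpos⟩ := exists_first_nonpos hx.2 hcont (by simpa using hlt)
    (by simpa using h0)
  have hmono : MonotoneOn (fun y => d y - η * (β - y)) (Icc x z) := by
    refine monotoneOn_of_hasDerivWithinAt_nonneg (f' := fun y => d' y + η) (convex_Icc x z)
      (hcont.mono (Icc_subset_Icc_right hz.2)) (fun y hy => ?_) (fun y hy => ?_)
    · rw [interior_Icc] at hy
      have hyI : y ∈ Ioo α β := ⟨hx.1.trans_lt hy.1, hy.2.trans_le hz.2⟩
      have := (hd' y hyI).sub (((hasDerivAt_id y).const_sub β).const_mul η)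
      exact (this.congr_deriv (by ring)).hasDerivWithinAt
    · rw [interior_Icc] at hy
      have hyI : y ∈ Ioo α β := ⟨hx.1.trans_lt hy.1, hy.2.trans_le hz.2⟩
      have h1 := hpos y ⟨hy.1.le, hy.2⟩
      have h2 : 0 ≤ η * (β - y) := mul_nonneg hη (by linarith [hyI.2])
      linarith [h y hyI (by linarith)]
  have h1 := hmono (left_mem_Icc.2 hz.1.le) (right_mem_Icc.2 hz.1.le) hz.1.le
  have h2 := hpos x ⟨le_rfl, hz.1⟩
  simp only [hz0] at h1
  linarith

/-- `Y` solves `Y' = b ρ(Y - G)` on `(0,1)` with terminal value `Y(1) = G(1)`. -/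
structure BackSol (b ρ G Y : ℝ → ℝ) : Prop where
  cont : ContinuousOn Y (Icc 0 1)
  terminal : Y 1 = G 1
  deriv : ∀ v ∈ Ioo (0 : ℝ) 1, HasDerivAt Y (b v * ρ (Y v - G v)) v

/-- Backward stability: inserting `b₁ ρ₁(Y₂ - G)` splits the derivative of the difference into a
part of favourable sign, by monotonicity of `ρ₁`, and an error of size `η`. It serves both the
regularization of `ρ` and the continuity in the speed. -/
lemma BackSol.abs_sub_le {b₁ b₂ ρ₁ ρ₂ G Y₁ Y₂ : ℝ → ℝ} {η : ℝ} (h₁ : BackSol b₁ ρ₁ G Y₁)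
    (h₂ : BackSol b₂ ρ₂ G Y₂) (hb : ∀ v ∈ Ioo (0 : ℝ) 1, 0 ≤ b₁ v) (hρ : Monotone ρ₁)
    (hη : ∀ v ∈ Ioo (0 : ℝ) 1, ∀ x, |b₁ v * ρ₁ x - b₂ v * ρ₂ x| ≤ η) {v : ℝ}
    (hv : v ∈ Icc (0 : ℝ) 1) : |Y₁ v - Y₂ v| ≤ η := by
  have hη0 : 0 ≤ η := (abs_nonneg _).trans (hη (1 / 2) (by norm_num) 0)
  have key : ∀ s : ℝ, |s| = 1 → s * (Y₁ v - Y₂ v) ≤ η := by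
    intro s hs
    have hs2 : s * s = 1 := by rw [← abs_mul_abs_self, hs, one_mul]
    refine (le_of_backward (d := fun v => s * (Y₁ v - Y₂ v)) (α := 0) (β := 1) hη0
      (continuousOn_const.mul (h₁.cont.sub h₂.cont))
      (fun x hx => ((h₁.deriv x hx).sub (h₂.deriv x hx)).const_mul s)
      (by simp [h₁.terminal, h₂.terminal]) (fun x hx hpos => ?_) hv).trans ?_
    · have h3 : 0 ≤ s * (b₁ x * ρ₁ (Y₁ x - G x) - b₁ x * ρ₁ (Y₂ x - G x)) := by
        rw [← mul_sub, mul_left_comm]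
        refine mul_nonneg (hb x hx) ?_
        rcases (abs_eq one_pos.le).1 hs with rfl | rfl
        · have : ρ₁ (Y₂ x - G x) ≤ ρ₁ (Y₁ x - G x) := hρ (by linarith)
          linarith
        · have : ρ₁ (Y₁ x - G x) ≤ ρ₁ (Y₂ x - G x) := hρ (by linarith)
          linarith
      have h4 : |s * (b₁ x * ρ₁ (Y₂ x - G x) - b₂ x * ρ₂ (Y₂ x - G x))| ≤ η := by
        rw [abs_mul, hs, one_mul]; exact hη x hx _
      have h5 := (abs_le.1 h4).1
      have h6 : s * (b₁ x * ρ₁ (Y₁ x - G x) - b₂ x * ρ₂ (Y₂ x - G x)) =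
        s * (b₁ x * ρ₁ (Y₁ x - G x) - b₁ x * ρ₁ (Y₂ x - G x)) +
          s * (b₁ x * ρ₁ (Y₂ x - G x) - b₂ x * ρ₂ (Y₂ x - G x)) := by ring
      linarith
    · nlinarith [hv.1]
  exact abs_le'.2 ⟨by simpa using key 1 (by simp), by simpa using key (-1) (by simp)⟩

lemma exists_backSol_of_lipschitz {b ρ G : ℝ → ℝ} {B R : ℝ} {k : NNReal}
    (hb : ContinuousOn b (Icc 0 1)) (hbB : ∀ v ∈ Icc (0 : ℝ) 1, |b v| ≤ B)
    (hG : ContinuousOn G (Icc 0 1)) (hρ : LipschitzWith k ρ) (hR : ∀ x, |ρ x| ≤ R) :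
    ∃ Y, BackSol b ρ G Y := by
  have hB : 0 ≤ B := (abs_nonneg _).trans (hbB 0 (by simp))
  have hR0 : 0 ≤ R := (abs_nonneg _).trans (hR 0)
  have hPL : IsPicardLindelof (fun v x => b v * ρ (x - G v)) (tmin := 0) (tmax := 1)
      ⟨1, by simp⟩ (G 1) (B * R).toNNReal 0 (B * R).toNNReal (B.toNNReal * k) := by
    refine ⟨fun t ht => LipschitzWith.lipschitzOnWith ?_, fun x _ => ?_, fun t ht x _ => ?_, ?_⟩
    · refine LipschitzWith.of_dist_le_mul fun x y => ?_
      have h1 := hρ.dist_le_mul (x - G t) (y - G t)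
      simp only [Real.dist_eq, NNReal.coe_mul, Real.coe_toNNReal B hB, ← mul_sub, abs_mul,
        sub_sub_sub_cancel_right] at h1 ⊢
      rw [mul_assoc]
      exact mul_le_mul (hbB t ht) h1 (abs_nonneg _) hB
    · exact hb.mul (hρ.continuous.comp_continuousOn (continuousOn_const.sub hG))
    · rw [Real.coe_toNNReal _ (mul_nonneg hB hR0), Real.norm_eq_abs, abs_mul]
      exact mul_le_mul (hbB t ht) (hR _) (abs_nonneg _) hB
    · simp
  obtain ⟨Y, hY1, hY⟩ := hPL.exists_eq_forall_mem_Icc_hasDerivWithinAt₀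
  exact ⟨Y, fun v hv => (hY v hv).continuousWithinAt, hY1,
    fun v hv => (hY v (Ioo_subset_Icc_self hv)).hasDerivAt (Icc_mem_nhds hv.1 hv.2)⟩

lemma BackSol.eq_integral {b ρ G Y : ℝ → ℝ} (h : BackSol b ρ G Y) (hb : ContinuousOn b (Icc 0 1))
    (hG : ContinuousOn G (Icc 0 1)) (hρ : Continuous ρ) {v : ℝ} (hv : v ∈ Icc (0 : ℝ) 1) :
    Y v = G 1 - ∫ t in v..1, b t * ρ (Y t - G t) := by
  have hsub : Icc v 1 ⊆ Icc (0 : ℝ) 1 := Icc_subset_Icc_left hv.1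
  have hc : ContinuousOn (fun t => b t * ρ (Y t - G t)) (Icc v 1) :=
    (hb.mul (hρ.comp_continuousOn (h.cont.sub hG))).mono hsub
  rw [intervalIntegral.integral_eq_sub_of_hasDerivAt_of_le hv.2 (h.cont.mono hsub)
    (fun t ht => h.deriv t ⟨hv.1.trans_lt ht.1, ht.2⟩)
    (ContinuousOn.intervalIntegrable (by rwa [uIcc_of_le hv.2])), h.terminal]
  ring

/-- Stability makes the approximate solutions uniformly Cauchy; dominated convergence passes the
integral equation to the limit, which is then differentiated. No Lipschitz bound on the limiting `ρ`
is needed. -/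
lemma backSol_of_tendsto {b ρ G : ℝ → ℝ} {ρn Yn : ℕ → ℝ → ℝ} {ε : ℕ → ℝ} {B R : ℝ}
    (hb : ContinuousOn b (Icc 0 1)) (hb0 : ∀ v ∈ Icc (0 : ℝ) 1, 0 ≤ b v)
    (hbB : ∀ v ∈ Icc (0 : ℝ) 1, b v ≤ B) (hG : ContinuousOn G (Icc 0 1)) (hρ : Continuous ρ)
    (hρn : ∀ n, Continuous (ρn n)) (hmono : ∀ n, Monotone (ρn n)) (hR : ∀ n x, |ρn n x| ≤ R)
    (hε : Tendsto ε atTop (𝓝 0)) (hclose : ∀ n x, |ρn n x - ρ x| ≤ ε n)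
    (hY : ∀ n, BackSol b (ρn n) G (Yn n)) : ∃ Y, BackSol b ρ G Y := by
  have hB : 0 ≤ B := (hb0 0 (by simp)).trans (hbB 0 (by simp))
  have hdist : ∀ n m, ∀ v ∈ Icc (0 : ℝ) 1, |Yn n v - Yn m v| ≤ B * (ε n + ε m) := by
    intro n m v hv
    refine (hY n).abs_sub_le (hY m) (fun v hv => hb0 v (Ioo_subset_Icc_self hv)) (hmono n)
      (fun v hv x => ?_) hv
    have hv' := Ioo_subset_Icc_self hv
    rw [← mul_sub, abs_mul, abs_of_nonneg (hb0 v hv')]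
    refine mul_le_mul (hbB v hv') ?_ (abs_nonneg _) hB
    have := abs_sub_le (ρn n x) (ρ x) (ρn m x)
    rw [abs_sub_comm (ρ x)] at this
    linarith [hclose n x, hclose m x]
  have hεB : Tendsto (fun n => B * (ε n + ε n)) atTop (𝓝 0) := by
    simpa using (hε.add hε).const_mul B
  have hlim : ∀ v ∈ Icc (0 : ℝ) 1, ∃ l, Tendsto (fun n => Yn n v) atTop (𝓝 l) := by
    intro v hv
    refine cauchySeq_tendsto_of_complete (Metric.cauchySeq_iff'.2 fun δ hδ => ?_)
    have h1 : ∀ᶠ n in atTop, B * ε n < δ / 2 := by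
      have : Tendsto (fun n => B * ε n) atTop (𝓝 0) := by simpa using hε.const_mul B
      exact this.eventually (gt_mem_nhds (half_pos hδ))
    obtain ⟨N, hN⟩ := eventually_atTop.1 h1
    refine ⟨N, fun n hn => ?_⟩
    rw [Real.dist_eq]
    linarith [hdist n N v hv, hN n hn, hN N le_rfl]
  choose! Y hYlim using hlim
  have hunif : TendstoUniformlyOn Yn Y atTop (Icc 0 1) := by
    rw [Metric.tendstoUniformlyOn_iff]
    intro δ hδ
    have h1 : Tendsto (fun n => B * ε n) atTop (𝓝 0) := by simpa using hε.const_mul B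
    filter_upwards [h1.eventually (gt_mem_nhds hδ)] with n hn v hv
    have h2 : |Yn n v - Y v| ≤ B * ε n := by
      refine le_of_tendsto_of_tendsto ((tendsto_const_nhds.sub (hYlim v hv)).abs)
        (by simpa using (tendsto_const_nhds (x := ε n)).add hε |>.const_mul B)
        (Eventually.of_forall fun m => hdist n m v hv)
    rw [dist_comm, Real.dist_eq]
    exact h2.trans_lt hn
  have hYc : ContinuousOn Y (Icc 0 1) :=
    hunif.continuousOn (Frequently.of_forall fun n => (hY n).cont)
  have hF : ContinuousOn (fun t => b t * ρ (Y t - G t)) (Icc 0 1) :=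
    hb.mul (hρ.comp_continuousOn (hYc.sub hG))
  have hptw : ∀ t ∈ Icc (0 : ℝ) 1,
      Tendsto (fun n => b t * ρn n (Yn n t - G t)) atTop (𝓝 (b t * ρ (Y t - G t))) := by
    intro t ht
    refine Tendsto.const_mul _ ?_
    have h1 : Tendsto (fun n => ρ (Yn n t - G t)) atTop (𝓝 (ρ (Y t - G t))) :=
      (hρ.tendsto _).comp ((hYlim t ht).sub_const _)
    have h2 : Tendsto (fun n => ρn n (Yn n t - G t) - ρ (Yn n t - G t)) atTop (𝓝 0) :=
      squeeze_zero_norm (fun n => hclose n _) hε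
    simpa using h2.add h1
  have hint : ∀ v ∈ Icc (0 : ℝ) 1, Y v = G 1 - ∫ t in v..1, b t * ρ (Y t - G t) := by
    intro v hv
    have hsub : uIoc v 1 ⊆ Icc (0 : ℝ) 1 := by
      rw [uIoc_of_le hv.2]; exact fun t ht => ⟨hv.1.trans ht.1.le, ht.2⟩
    have h1 : Tendsto (fun n => ∫ t in v..1, b t * ρn n (Yn n t - G t)) atTop
        (𝓝 (∫ t in v..1, b t * ρ (Y t - G t))) := by
      refine intervalIntegral.tendsto_integral_filter_of_dominated_convergence
        (fun _ => B * R) (Eventually.of_forall fun n => ?_) (Eventually.of_forall fun n => ?_)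
        intervalIntegrable_const ?_
      · exact ((hb.mul ((hρn n).comp_continuousOn ((hY n).cont.sub hG))).mono
          hsub).aestronglyMeasurable measurableSet_uIoc
      · refine Eventually.of_forall fun t ht => ?_
        rw [Real.norm_eq_abs, abs_mul, abs_of_nonneg (hb0 t (hsub ht))]
        exact mul_le_mul (hbB t (hsub ht)) (hR n _) (abs_nonneg _) hB
      · exact Eventually.of_forall fun t ht => hptw t (hsub ht)
    refine tendsto_nhds_unique (hYlim v hv) ?_
    refine (tendsto_const_nhds.sub h1).congr fun n => ?_
    exact ((hY n).eq_integral hb hG (hρn n) hv).symm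
  refine ⟨Y, hYc, by simpa using hint 1 (by simp), fun v hv => ?_⟩
  have hv' := Ioo_subset_Icc_self hv
  have hI : IntervalIntegrable (fun t => b t * ρ (Y t - G t)) volume v 1 :=
    ContinuousOn.intervalIntegrable
      (by rw [uIcc_of_le hv.2.le]; exact hF.mono (Icc_subset_Icc_left hv'.1))
  have hd := (intervalIntegral.integral_hasDerivAt_left hI
    ((hF.mono Ioo_subset_Icc_self).stronglyMeasurableAtFilter isOpen_Ioo v hv)
    (hF.continuousAt (Icc_mem_nhds hv.1 hv.2))).const_sub (G 1)
  rw [neg_neg] at hd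
  refine hd.congr_of_eventuallyEq ?_
  filter_upwards [Icc_mem_nhds hv.1 hv.2] with t ht using hint t ht

/-! ### The terminal value problem for the power-type phase plane equation -/

/-- The power `r ≤ 1` need not be Lipschitz at `0`. Truncating to `[0, M]` and shifting the base by
`1/(n+1)` gives bounded, monotone, Lipschitz approximations. -/
lemma exists_backSol_rpow {b G : ℝ → ℝ} {q r M B : ℝ} (hq : 0 ≤ q) (hr : 0 < r) (hr1 : r ≤ 1)
    (hM : 0 ≤ M) (hb : ContinuousOn b (Icc 0 1)) (hb0 : ∀ v ∈ Icc (0 : ℝ) 1, 0 ≤ b v)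
    (hbB : ∀ v ∈ Icc (0 : ℝ) 1, b v ≤ B) (hG : ContinuousOn G (Icc 0 1)) :
    ∃ Y, BackSol b (fun x => q * min (max x 0) M ^ r) G Y := by
  have hcl : LipschitzWith 1 (fun x : ℝ => min (max x 0) M) :=
    (LipschitzWith.id.max_const 0).min_const M
  have hcl0 : ∀ x : ℝ, 0 ≤ min (max x 0) M := fun x => le_min (le_max_right _ _) hM
  have hclM : ∀ x : ℝ, min (max x 0) M ≤ M := fun x => min_le_right _ _
  have hε0 : ∀ n : ℕ, (0 : ℝ) < 1 / ((n : ℝ) + 1) := fun n => by positivity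
  have hε1 : ∀ n : ℕ, 1 / ((n : ℝ) + 1) ≤ 1 := fun n => by
    rw [div_le_one (by positivity)]; linarith [n.cast_nonneg (α := ℝ)]
  have hlip : ∀ n : ℕ, ∃ k : NNReal,
      LipschitzWith k (fun x : ℝ => q * (min (max x 0) M + 1 / ((n : ℝ) + 1)) ^ r) := by
    intro n
    set ε := 1 / ((n : ℝ) + 1) with hε
    have hC : 0 ≤ q * (r * ε ^ (r - 1)) := by have := hε0 n; positivity
    refine ⟨⟨_, hC⟩, LipschitzWith.of_dist_le_mul fun x y => ?_⟩
    have h1 : ∀ s ∈ Ici (0 : ℝ), HasDerivWithinAt (fun s : ℝ => q * (s + ε) ^ r)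
        (q * (r * (s + ε) ^ (r - 1))) (Ici 0) s := by
      intro s hs
      have hpos : 0 < s + ε := add_pos_of_nonneg_of_pos hs (hε0 n)
      have := (((hasDerivAt_id s).add_const ε).rpow_const (p := r) (Or.inl hpos.ne')).const_mul q
      exact (this.congr_deriv (by simp)).hasDerivWithinAt
    have h2 := Convex.norm_image_sub_le_of_norm_hasDerivWithin_le (C := q * (r * ε ^ (r - 1))) h1
      (fun s hs => by
        have hpos : 0 < s + ε := add_pos_of_nonneg_of_pos hs (hε0 n)
        rw [Real.norm_of_nonneg (by positivity)]
        have : (s + ε) ^ (r - 1) ≤ ε ^ (r - 1) :=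
          Real.rpow_le_rpow_of_nonpos (hε0 n) (le_add_of_nonneg_left hs) (by linarith)
        gcongr) (convex_Ici 0) (hcl0 y) (hcl0 x)
    refine h2.trans (mul_le_mul_of_nonneg_left ?_ hC)
    simpa [Real.dist_eq] using hcl.dist_le_mul x y
  choose k hk using hlip
  have hR : ∀ (n : ℕ) (x : ℝ), |q * (min (max x 0) M + 1 / ((n : ℝ) + 1)) ^ r| ≤
      q * (M + 1) ^ r := by
    intro n x
    have h0 : 0 ≤ min (max x 0) M + 1 / ((n : ℝ) + 1) := add_nonneg (hcl0 x) (hε0 n).le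
    rw [abs_of_nonneg (mul_nonneg hq (Real.rpow_nonneg h0 r))]
    exact mul_le_mul_of_nonneg_left
      (Real.rpow_le_rpow h0 (add_le_add (hclM x) (hε1 n)) hr.le) hq
  have habs : ∀ v ∈ Icc (0 : ℝ) 1, |b v| ≤ B := fun v hv => by
    rw [abs_of_nonneg (hb0 v hv)]; exact hbB v hv
  choose Yn hYn using fun n => exists_backSol_of_lipschitz hb habs hG (hk n) (hR n)
  refine backSol_of_tendsto (ε := fun n : ℕ => q * (1 / ((n : ℝ) + 1)) ^ r) hb hb0 hbB hG
    (continuous_const.mul (hcl.continuous.rpow_const fun _ => Or.inr hr.le))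
    (fun n => (hk n).continuous) (fun n x y hxy => ?_) hR ?_ (fun n x => ?_) hYn
  · have h0 : 0 ≤ min (max x 0) M + 1 / ((n : ℝ) + 1) := add_nonneg (hcl0 x) (hε0 n).le
    refine mul_le_mul_of_nonneg_left (Real.rpow_le_rpow h0 ?_ hr.le) hq
    gcongr
  · have h1 := (tendsto_one_div_add_atTop_nhds_zero_nat (𝕜 := ℝ)).rpow_const
      (p := r) (Or.inr hr.le)
    simpa [Real.zero_rpow hr.ne'] using h1.const_mul q
  -- Subadditivity of `x ^ r` for `r ≤ 1` bounds the effect of the shift uniformly in `x`.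
  · have h1 := Real.rpow_add_le_add_rpow (hcl0 x) (hε0 n).le hr.le hr1
    have h2 : min (max x 0) M ^ r ≤ (min (max x 0) M + 1 / ((n : ℝ) + 1)) ^ r :=
      Real.rpow_le_rpow (hcl0 x) (le_add_of_nonneg_right (hε0 n).le) hr.le
    rw [← mul_sub, abs_of_nonneg (mul_nonneg hq (sub_nonneg.2 h2))]
    exact mul_le_mul_of_nonneg_left (by linarith) hq

/-- A reaction term of combustion type on `(0,1)`, with ignition value `θ`. -/
structure IsReaction (θ : ℝ) (f : ℝ → ℝ) : Prop where
  mem : θ ∈ Ioo (0 : ℝ) 1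
  cont : ContinuousOn f (Ioo 0 1)
  zero : ∀ v ∈ Ioc 0 θ, f v = 0
  pos : ∀ v ∈ Ioo θ 1, 0 < f v
  integrable : IntervalIntegrable f volume 0 1

lemma IsReaction.nonneg {θ : ℝ} {f : ℝ → ℝ} (hf : IsReaction θ f) {v : ℝ}
    (hv : v ∈ Ioo (0 : ℝ) 1) : 0 ≤ f v := by
  rcases le_or_gt v θ with h | h
  · exact (hf.zero v ⟨hv.1, h⟩).ge
  · exact (hf.pos v ⟨h, hv.2⟩).le

lemma IsReaction.hasDerivAt_integral {θ : ℝ} {f : ℝ → ℝ} (hf : IsReaction θ f) {v : ℝ}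
    (hv : v ∈ Ioo (0 : ℝ) 1) : HasDerivAt (fun v => ∫ t in (0 : ℝ)..v, f t) (f v) v :=
  intervalIntegral.integral_hasDerivAt_right
    (hf.integrable.mono_set (by
      rw [uIcc_of_le hv.1.le, uIcc_of_le zero_le_one]; exact Icc_subset_Icc_right hv.2.le))
    (hf.cont.stronglyMeasurableAtFilter isOpen_Ioo v hv)
    (hf.cont.continuousAt (Ioo_mem_nhds hv.1 hv.2))

lemma IsReaction.continuousOn_integral {θ : ℝ} {f : ℝ → ℝ} (hf : IsReaction θ f) :
    ContinuousOn (fun v => ∫ t in (0 : ℝ)..v, f t) (Icc 0 1) := by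
  have := intervalIntegral.continuousOn_primitive_interval' hf.integrable (left_mem_uIcc)
  rwa [uIcc_of_le zero_le_one] at this

lemma IsReaction.monotoneOn_integral {θ : ℝ} {f : ℝ → ℝ} (hf : IsReaction θ f) :
    MonotoneOn (fun v => ∫ t in (0 : ℝ)..v, f t) (Icc 0 1) := by
  refine monotoneOn_of_hasDerivWithinAt_nonneg (f' := f) (convex_Icc 0 1) hf.continuousOn_integral
    (fun v hv => ?_) (fun v hv => ?_) <;> rw [interior_Icc] at hv
  · exact (hf.hasDerivAt_integral hv).hasDerivWithinAt
  · exact hf.nonneg hv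

lemma IsReaction.integral_theta {θ : ℝ} {f : ℝ → ℝ} (hf : IsReaction θ f) :
    ∫ t in (0 : ℝ)..θ, f t = 0 := by
  rw [intervalIntegral.integral_of_le hf.mem.1.le]
  exact setIntegral_eq_zero_of_forall_eq_zero hf.zero

lemma IsReaction.integral_pos {θ : ℝ} {f : ℝ → ℝ} (hf : IsReaction θ f) :
    0 < ∫ t in (0 : ℝ)..1, f t := by
  have h : StrictMonoOn (fun v => ∫ t in (0 : ℝ)..v, f t) (Icc θ 1) := by
    refine strictMonoOn_of_hasDerivWithinAt_pos (f' := f) (convex_Icc θ 1)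
      (hf.continuousOn_integral.mono (Icc_subset_Icc_left hf.mem.1.le))
      (fun v hv => ?_) (fun v hv => ?_) <;> rw [interior_Icc] at hv
    · exact (hf.hasDerivAt_integral ⟨hf.mem.1.trans hv.1, hv.2⟩).hasDerivWithinAt
    · exact hf.pos v hv
  have := h (left_mem_Icc.2 hf.mem.2.le) (right_mem_Icc.2 hf.mem.2.le) hf.mem.2
  simpa only [hf.integral_theta] using this

/-! ### The function `c v + H(v)` -/

lemma hMin_le {h : ℝ → ℝ} (hh : ContinuousOn h (Icc 0 1)) {v : ℝ} (hv : v ∈ Icc (0 : ℝ) 1) :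
    hMin h ≤ h v :=
  csInf_le (isCompact_Icc.image_of_continuousOn hh).bddBelow (mem_image_of_mem h hv)

lemma hasDerivAt_linear_add_fluxH {h : ℝ → ℝ} (hh : ContinuousOn h (Icc 0 1)) (c : ℝ) {v : ℝ}
    (hv : v ∈ Ioo (0 : ℝ) 1) : HasDerivAt (fun v => c * v + fluxH h v) (c + h v) v := by
  have h1 : HasDerivAt (fluxH h) (h v) v := intervalIntegral.integral_hasDerivAt_right
    (ContinuousOn.intervalIntegrable
      (by rw [uIcc_of_le hv.1.le]; exact hh.mono (Icc_subset_Icc_right hv.2.le)))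
    ((hh.mono Ioo_subset_Icc_self).stronglyMeasurableAtFilter isOpen_Ioo v hv)
    (hh.continuousAt (Icc_mem_nhds hv.1 hv.2))
  exact (((hasDerivAt_id v).const_mul c).add h1).congr_deriv (by simp)

lemma continuousOn_linear_add_fluxH {h : ℝ → ℝ} (hh : ContinuousOn h (Icc 0 1)) (c : ℝ) :
    ContinuousOn (fun v => c * v + fluxH h v) (Icc 0 1) := by
  have h1 : IntervalIntegrable h volume 0 1 :=
    ContinuousOn.intervalIntegrable (by rwa [uIcc_of_le zero_le_one])
  have := intervalIntegral.continuousOn_primitive_interval' h1 (left_mem_uIcc)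
  rw [uIcc_of_le zero_le_one] at this
  exact ContinuousOn.add (by fun_prop) this

lemma linear_add_fluxH_zero (h : ℝ → ℝ) (c : ℝ) : c * 0 + fluxH h 0 = 0 := by simp [fluxH]

lemma strictMonoOn_linear_add_fluxH {h : ℝ → ℝ} (hh : ContinuousOn h (Icc 0 1)) {c : ℝ}
    (hc : -hMin h < c) : StrictMonoOn (fun v => c * v + fluxH h v) (Icc 0 1) := by
  refine strictMonoOn_of_hasDerivWithinAt_pos (f' := fun v => c + h v) (convex_Icc 0 1)
    (continuousOn_linear_add_fluxH hh c) (fun v hv => ?_) (fun v hv => ?_) <;>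
    rw [interior_Icc] at hv
  · exact (hasDerivAt_linear_add_fluxH hh c hv).hasDerivWithinAt
  · linarith [hMin_le hh (Ioo_subset_Icc_self hv)]

lemma monotoneOn_linear_add_fluxH {h : ℝ → ℝ} (hh : ContinuousOn h (Icc 0 1)) {c : ℝ}
    (hc : -hMin h ≤ c) : MonotoneOn (fun v => c * v + fluxH h v) (Icc 0 1) := by
  refine monotoneOn_of_hasDerivWithinAt_nonneg (f' := fun v => c + h v) (convex_Icc 0 1)
    (continuousOn_linear_add_fluxH hh c) (fun v hv => ?_) (fun v hv => ?_) <;>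
    rw [interior_Icc] at hv
  · exact (hasDerivAt_linear_add_fluxH hh c hv).hasDerivWithinAt
  · linarith [hMin_le hh (Ioo_subset_Icc_self hv)]

lemma linear_add_fluxH_nonneg {h : ℝ → ℝ} (hh : ContinuousOn h (Icc 0 1)) {c : ℝ}
    (hc : -hMin h ≤ c) {v : ℝ} (hv : v ∈ Icc (0 : ℝ) 1) : 0 ≤ c * v + fluxH h v := by
  have := monotoneOn_linear_add_fluxH hh hc (left_mem_Icc.2 zero_le_one) hv hv.1
  simpa only [linear_add_fluxH_zero] using this

lemma linear_add_fluxH_pos {h : ℝ → ℝ} (hh : ContinuousOn h (Icc 0 1)) {c : ℝ}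
    (hc : -hMin h < c) {v : ℝ} (hv : v ∈ Ioc (0 : ℝ) 1) : 0 < c * v + fluxH h v := by
  have := strictMonoOn_linear_add_fluxH hh hc (left_mem_Icc.2 zero_le_one)
    (Ioc_subset_Icc_self hv) hv.1
  simpa only [linear_add_fluxH_zero] using this

/-- `y` solves `y' = q ((c + h) y^(1-1/q) - f)` on `(0,1)` with terminal value `y(1) = 0`. -/
structure PhaseSol (q : ℝ) (h f : ℝ → ℝ) (c : ℝ) (y : ℝ → ℝ) : Prop where
  cont : ContinuousOn y (Icc 0 1)
  terminal : y 1 = 0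
  nonneg : ∀ v ∈ Icc (0 : ℝ) 1, 0 ≤ y v
  deriv : ∀ v ∈ Ioo (0 : ℝ) 1, HasDerivAt y (q * ((c + h v) * y v ^ ((q - 1) / q) - f v)) v

/-- The reaction may be unbounded near `1`, so one solves for `Y = y + G` with `G = q ∫₀ᵛ f`: this
removes `f` from the right side and leaves continuous coefficients. -/
lemma exists_phaseSol {q θ : ℝ} {h f : ℝ → ℝ} (hq : 1 < q) (hh : ContinuousOn h (Icc 0 1))
    (hf : IsReaction θ f) : ∃ y : ℝ → ℝ → ℝ, (∀ c, -hMin h ≤ c → PhaseSol q h f c (y c)) ∧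
      ∀ v ∈ Icc (0 : ℝ) 1, ContinuousOn (fun c => y c v) (Ici (-hMin h)) := by
  set G : ℝ → ℝ := fun v => q * ∫ t in (0 : ℝ)..v, f t with hGdef
  have hq0 : 0 < q := by linarith
  have hGc : ContinuousOn G (Icc 0 1) := continuousOn_const.mul hf.continuousOn_integral
  have hG0 : ∀ v ∈ Icc (0 : ℝ) 1, 0 ≤ G v := fun v hv => by
    have := hf.monotoneOn_integral (left_mem_Icc.2 zero_le_one) hv hv.1
    simp only [intervalIntegral.integral_same] at this
    exact mul_nonneg hq0.le this
  have hr : 0 < (q - 1) / q := div_pos (by linarith) hq0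
  have hr1 : (q - 1) / q ≤ 1 := (div_le_one hq0).2 (by linarith)
  have hM : 0 ≤ G 1 := hG0 1 (by simp)
  obtain ⟨B, hB⟩ := (isCompact_Icc.image_of_continuousOn hh).bddAbove
  have hb0 : ∀ c, -hMin h ≤ c → ∀ v ∈ Icc (0 : ℝ) 1, 0 ≤ c + h v := fun c hc v hv => by
    linarith [hMin_le hh hv]
  have hex : ∀ c, -hMin h ≤ c → ∃ Y,
      BackSol (fun v => c + h v) (fun x => q * min (max x 0) (G 1) ^ ((q - 1) / q)) G Y :=
    fun c hc => exists_backSol_rpow hq0.le hr hr1 hM (continuousOn_const.add hh)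
      (hb0 c hc) (B := c + B) (fun v hv => by linarith [hB (mem_image_of_mem h hv)]) hGc
  choose! Y hY using hex
  refine ⟨fun c v => Y c v - G v, fun c hc => ?_, fun v hv => ?_⟩
  · have hYc := hY c hc
    have hGd : ∀ v ∈ Ioo (0 : ℝ) 1, HasDerivAt G (q * f v) v := fun v hv =>
      (hf.hasDerivAt_integral hv).const_mul q
    -- Where `y < 0` the truncated power vanishes and `y' = -q f ≤ 0`, so `y` could not return to
    -- `0` at `1`. Together with `Y ≤ G 1` below, this shows that the truncation is inactive.
    have hnn : ∀ v ∈ Icc (0 : ℝ) 1, 0 ≤ Y c v - G v := by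
      intro v hv
      have := le_of_backward (d := fun v => -(Y c v - G v)) (α := 0) (β := 1) le_rfl
        (hYc.cont.sub hGc).neg (fun x hx => ((hYc.deriv x hx).sub (hGd x hx)).neg)
        (by simp [hYc.terminal]) (fun x hx hpos => ?_) hv
      · linarith
      · rw [max_eq_right (by linarith), min_eq_left hM, Real.zero_rpow hr.ne']
        have := mul_nonneg hq0.le (hf.nonneg hx)
        simpa using this
    have hYle : ∀ v ∈ Icc (0 : ℝ) 1, Y c v ≤ G 1 := by
      have hm : MonotoneOn (Y c) (Icc 0 1) := by
        refine monotoneOn_of_hasDerivWithinAt_nonneg (convex_Icc 0 1) hYc.cont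
          (fun v hv => (hYc.deriv v (by rwa [interior_Icc] at hv)).hasDerivWithinAt)
          (fun v hv => ?_)
        rw [interior_Icc] at hv
        exact mul_nonneg (hb0 c hc v (Ioo_subset_Icc_self hv))
          (mul_nonneg hq0.le (Real.rpow_nonneg (le_min (le_max_right _ _) hM) _))
      intro v hv
      rw [← hYc.terminal]
      exact hm hv (right_mem_Icc.2 zero_le_one) hv.2
    refine ⟨hYc.cont.sub hGc, by simp [hYc.terminal], hnn, fun v hv => ?_⟩
    have hv' := Ioo_subset_Icc_self hv
    have hd := (hYc.deriv v hv).sub (hGd v hv)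
    rw [max_eq_left (hnn v hv'), min_eq_left (by linarith [hYle v hv', hG0 v hv'])] at hd
    exact hd.congr_deriv (by ring)
  · set L := q * G 1 ^ ((q - 1) / q)
    have hL : 0 ≤ L := mul_nonneg hq0.le (Real.rpow_nonneg hM _)
    refine LipschitzOnWith.continuousOn (K := ⟨L, hL⟩)
      (LipschitzOnWith.of_dist_le_mul fun c hc c' hc' => ?_)
    have h1 := (hY c hc).abs_sub_le (hY c' hc') (η := L * |c - c'|)
      (fun v hv => hb0 c hc v (Ioo_subset_Icc_self hv)) (fun x y hxy => ?_)
      (fun v _ x => ?_) hv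
    · rw [Real.dist_eq, Real.dist_eq, sub_sub_sub_cancel_right]; exact h1
    · refine mul_le_mul_of_nonneg_left (Real.rpow_le_rpow (le_min (le_max_right _ _) hM) ?_ hr.le)
        hq0.le
      gcongr
    · have h2 : 0 ≤ min (max x 0) (G 1) := le_min (le_max_right _ _) hM
      have h3 : 0 ≤ q * min (max x 0) (G 1) ^ ((q - 1) / q) :=
        mul_nonneg hq0.le (Real.rpow_nonneg h2 _)
      rw [← sub_mul, add_sub_add_right_eq_sub, abs_mul, abs_of_nonneg h3, mul_comm]
      exact mul_le_mul_of_nonneg_right (mul_le_mul_of_nonneg_left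
        (Real.rpow_le_rpow h2 (min_le_right _ _) hr.le) hq0.le) (abs_nonneg _)

/-! ### Phase plane estimates and the shooting argument -/

/-- An interior zero would be a minimum of `y`, yet the equation gives `y' = -q f < 0` there. -/
lemma PhaseSol.pos {q θ c : ℝ} {h f y : ℝ → ℝ} (hy : PhaseSol q h f c y) (hq : 1 < q)
    (hf : IsReaction θ f) {v : ℝ} (hv : v ∈ Ioo θ 1) : 0 < y v := by
  have hv1 : v ∈ Ioo (0 : ℝ) 1 := ⟨hf.mem.1.trans hv.1, hv.2⟩
  refine lt_of_le_of_ne (hy.nonneg v (Ioo_subset_Icc_self hv1)) fun h0 => ?_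
  have hmin : IsLocalMin y v := by
    filter_upwards [Ioo_mem_nhds hv1.1 hv1.2] with x hx
    rw [← h0]; exact hy.nonneg x (Ioo_subset_Icc_self hx)
  have h1 := hmin.hasDerivAt_eq_zero (hy.deriv v hv1)
  rw [← h0, Real.zero_rpow (div_pos (by linarith) (by linarith)).ne'] at h1
  have := mul_pos (by linarith : 0 < q) (hf.pos v hv)
  linarith

lemma rpow_inv_rpow_sub_one {q y : ℝ} (hy : 0 ≤ y) :
    (y ^ (1 / q)) ^ (q - 1) = y ^ ((q - 1) / q) := by
  rw [← Real.rpow_mul hy]; congr 1; ring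

lemma rpow_sub_one_div {q w : ℝ} (hq : 0 < q) (hw : 0 ≤ w) :
    (w ^ q) ^ ((q - 1) / q) = w ^ (q - 1) := by
  rw [← Real.rpow_mul hw]; congr 1; field_simp

lemma PhaseSol.hasDerivAt_root {q c : ℝ} {h f y : ℝ → ℝ} (hy : PhaseSol q h f c y) (hq : 1 < q)
    {v : ℝ} (hv : v ∈ Ioo (0 : ℝ) 1) (hpos : 0 < y v) :
    HasDerivAt (fun v => y v ^ (1 / q)) (c + h v - f v / (y v ^ (1 / q)) ^ (q - 1)) v := by
  have hq0 : 0 < q := by linarith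
  have h1 := (hy.deriv v hv).rpow_const (p := 1 / q) (Or.inl hpos.ne')
  refine h1.congr_deriv ?_
  rw [rpow_inv_rpow_sub_one hpos.le]
  have h2 : y v ^ (1 / q - 1) = (y v ^ ((q - 1) / q))⁻¹ := by
    rw [← Real.rpow_neg hpos.le]; congr 1; field_simp; ring
  have h3 : 0 < y v ^ ((q - 1) / q) := Real.rpow_pos_of_pos hpos _
  rw [h2]
  field_simp

lemma PhaseSol.continuousOn_root {q c : ℝ} {h f y : ℝ → ℝ} (hy : PhaseSol q h f c y)
    (hq : 1 < q) : ContinuousOn (fun v => y v ^ (1 / q)) (Icc 0 1) :=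
  hy.cont.rpow_const fun _ _ => Or.inr (by positivity)

lemma hasDerivAt_speed_rpow {q c : ℝ} {h : ℝ → ℝ} (hq : 1 < q) (hh : ContinuousOn h (Icc 0 1))
    {v : ℝ} (hv : v ∈ Ioo (0 : ℝ) 1) :
    HasDerivAt (fun v => (c * v + fluxH h v) ^ q)
      (q * ((c + h v) * (c * v + fluxH h v) ^ (q - 1))) v :=
  ((hasDerivAt_linear_add_fluxH hh c hv).rpow_const (p := q) (Or.inr hq.le)).congr_deriv (by ring)

lemma continuousOn_speed_rpow {q c : ℝ} {h : ℝ → ℝ} (hq : 1 < q) (hh : ContinuousOn h (Icc 0 1)) :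
    ContinuousOn (fun v => (c * v + fluxH h v) ^ q) (Icc 0 1) :=
  (continuousOn_linear_add_fluxH hh c).rpow_const fun _ _ => Or.inr (by linarith)

/-- Past `θ` the root `y^(1/q)` grows no faster than `K`, so it stays below it. This makes `y - K^q
+ q ∫ f` nonincreasing, and its values at `θ` and `1` are compared. -/
lemma PhaseSol.integral_le_of_le {q θ c : ℝ} {h f y : ℝ → ℝ} (hy : PhaseSol q h f c y)
    (hq : 1 < q) (hh : ContinuousOn h (Icc 0 1)) (hf : IsReaction θ f) (hc : -hMin h ≤ c)
    (hle : y θ ≤ (c * θ + fluxH h θ) ^ q) :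
    q * ∫ v in (0 : ℝ)..1, f v ≤ (c * 1 + fluxH h 1) ^ q := by
  have hq0 : 0 < q := by linarith
  have hsub : Icc θ 1 ⊆ Icc (0 : ℝ) 1 := Icc_subset_Icc_left hf.mem.1.le
  have hsub' : ∀ v ∈ Ioo θ 1, v ∈ Ioo (0 : ℝ) 1 := fun v hv => ⟨hf.mem.1.trans hv.1, hv.2⟩
  have hθ : θ ∈ Icc (0 : ℝ) 1 := Ioo_subset_Icc_self hf.mem
  have hroot : ∀ v ∈ Icc θ 1, y v ^ (1 / q) ≤ c * v + fluxH h v := by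
    have hanti : AntitoneOn (fun v => y v ^ (1 / q) - (c * v + fluxH h v)) (Icc θ 1) := by
      refine antitoneOn_of_hasDerivWithinAt_nonpos (convex_Icc θ 1)
        (((hy.continuousOn_root hq).sub (continuousOn_linear_add_fluxH hh c)).mono hsub)
        (f' := fun v => c + h v - f v / (y v ^ (1 / q)) ^ (q - 1) - (c + h v))
        (fun v hv => ?_) (fun v hv => ?_) <;> rw [interior_Icc] at hv
      · exact ((hy.hasDerivAt_root hq (hsub' v hv) (hy.pos hq hf hv)).sub
          (hasDerivAt_linear_add_fluxH hh c (hsub' v hv))).hasDerivWithinAt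
      · have h1 : 0 ≤ f v / (y v ^ (1 / q)) ^ (q - 1) :=
          div_nonneg (hf.pos v hv).le (Real.rpow_nonneg
            (Real.rpow_nonneg (hy.pos hq hf hv).le _) _)
        linarith
    intro v hv
    have h1 := hanti (left_mem_Icc.2 hf.mem.2.le) hv hv.1
    have h2 : y θ ^ (1 / q) ≤ c * θ + fluxH h θ := by
      have := Real.rpow_le_rpow (hy.nonneg θ hθ) hle (by positivity : 0 ≤ 1 / q)
      rwa [← Real.rpow_mul (linear_add_fluxH_nonneg hh hc hθ), mul_one_div_cancel hq0.ne',
        Real.rpow_one] at this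
    simp only at h1
    linarith
  have hanti : AntitoneOn (fun v => y v - (c * v + fluxH h v) ^ q
      + q * ∫ t in (0 : ℝ)..v, f t) (Icc θ 1) := by
    refine antitoneOn_of_hasDerivWithinAt_nonpos (convex_Icc θ 1)
      (((hy.cont.sub (continuousOn_speed_rpow hq hh)).add
        (continuousOn_const.mul hf.continuousOn_integral)).mono hsub)
      (f' := fun v => q * ((c + h v) * y v ^ ((q - 1) / q) - f v)
        - q * ((c + h v) * (c * v + fluxH h v) ^ (q - 1)) + q * f v)
      (fun v hv => ?_) (fun v hv => ?_) <;> rw [interior_Icc] at hv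
    · exact (((hy.deriv v (hsub' v hv)).sub (hasDerivAt_speed_rpow hq hh (hsub' v hv))).add
        ((hf.hasDerivAt_integral (hsub' v hv)).const_mul q)).hasDerivWithinAt
    · have hv1 := Ioo_subset_Icc_self (hsub' v hv)
      have h1 : y v ^ ((q - 1) / q) ≤ (c * v + fluxH h v) ^ (q - 1) := by
        rw [← rpow_inv_rpow_sub_one (hy.nonneg v hv1)]
        exact Real.rpow_le_rpow (Real.rpow_nonneg (hy.nonneg v hv1) _)
          (hroot v (Ioo_subset_Icc_self hv)) (by linarith)
      have h2 : 0 ≤ c + h v := by linarith [hMin_le hh hv1]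
      have := mul_nonneg (mul_nonneg hq0.le h2) (sub_nonneg.2 h1)
      linarith
  have h1 := hanti (left_mem_Icc.2 hf.mem.2.le) (right_mem_Icc.2 hf.mem.2.le) hf.mem.2.le
  simp only [hy.terminal, hf.integral_theta] at h1
  linarith

lemma PhaseSol.le_integral {q θ c : ℝ} {h f y : ℝ → ℝ} (hy : PhaseSol q h f c y)
    (hq : 1 < q) (hh : ContinuousOn h (Icc 0 1)) (hf : IsReaction θ f) (hc : -hMin h ≤ c) :
    y θ ≤ q * ∫ v in (0 : ℝ)..1, f v := by
  have hq0 : 0 < q := by linarith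
  have hmono : MonotoneOn (fun v => y v + q * ∫ t in (0 : ℝ)..v, f t) (Icc 0 1) := by
    refine monotoneOn_of_hasDerivWithinAt_nonneg (convex_Icc 0 1)
      (hy.cont.add (continuousOn_const.mul hf.continuousOn_integral))
      (f' := fun v => q * ((c + h v) * y v ^ ((q - 1) / q) - f v) + q * f v)
      (fun v hv => ?_) (fun v hv => ?_) <;> rw [interior_Icc] at hv
    · exact ((hy.deriv v hv).add
        ((hf.hasDerivAt_integral hv).const_mul q)).hasDerivWithinAt
    · have hv1 := Ioo_subset_Icc_self hv
      have h1 := Real.rpow_nonneg (hy.nonneg v hv1) ((q - 1) / q)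
      have h2 : 0 ≤ c + h v := by linarith [hMin_le hh hv1]
      have := mul_nonneg hq0.le (mul_nonneg h2 h1)
      linarith
  have h1 := hmono (Ioo_subset_Icc_self hf.mem) (right_mem_Icc.2 zero_le_one) hf.mem.2.le
  simpa [hy.terminal, hf.integral_theta] using h1

lemma PhaseSol.lt_integral {q θ c : ℝ} {h f y : ℝ → ℝ} (hy : PhaseSol q h f c y)
    (hq : 1 < q) (hh : ContinuousOn h (Icc 0 1)) (hf : IsReaction θ f) (hc : -hMin h < c) :
    y θ < q * ∫ v in (0 : ℝ)..1, f v := by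
  have hq0 : 0 < q := by linarith
  have hsub : Icc θ 1 ⊆ Icc (0 : ℝ) 1 := Icc_subset_Icc_left hf.mem.1.le
  have hsub' : ∀ v ∈ Ioo θ 1, v ∈ Ioo (0 : ℝ) 1 := fun v hv => ⟨hf.mem.1.trans hv.1, hv.2⟩
  have hmono : StrictMonoOn (fun v => y v + q * ∫ t in (0 : ℝ)..v, f t) (Icc θ 1) := by
    refine strictMonoOn_of_hasDerivWithinAt_pos (convex_Icc θ 1)
      ((hy.cont.add (continuousOn_const.mul hf.continuousOn_integral)).mono hsub)
      (f' := fun v => q * ((c + h v) * y v ^ ((q - 1) / q) - f v) + q * f v)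
      (fun v hv => ?_) (fun v hv => ?_) <;> rw [interior_Icc] at hv
    · exact ((hy.deriv v (hsub' v hv)).add
        ((hf.hasDerivAt_integral (hsub' v hv)).const_mul q)).hasDerivWithinAt
    · have h1 := Real.rpow_pos_of_pos (hy.pos hq hf hv) ((q - 1) / q)
      have h2 : 0 < c + h v := by linarith [hMin_le hh (Ioo_subset_Icc_self (hsub' v hv))]
      have := mul_pos hq0 (mul_pos h2 h1)
      linarith
  have h1 := hmono (left_mem_Icc.2 hf.mem.2.le) (right_mem_Icc.2 hf.mem.2.le) hf.mem.2
  simpa [hy.terminal, hf.integral_theta] using h1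

/-- On `[0, θ]`, where `f = 0`, both functions solve the same equation with right side nondecreasing
in the unknown, so agreement at `θ` propagates backwards. -/
lemma PhaseSol.eq_speed_rpow {q θ c : ℝ} {h f y : ℝ → ℝ} (hy : PhaseSol q h f c y)
    (hq : 1 < q) (hh : ContinuousOn h (Icc 0 1)) (hf : IsReaction θ f) (hc : -hMin h ≤ c)
    (hθ : y θ = (c * θ + fluxH h θ) ^ q) {v : ℝ} (hv : v ∈ Icc 0 θ) :
    y v = (c * v + fluxH h v) ^ q := by
  have hq0 : 0 < q := by linarith
  have hr : 0 ≤ (q - 1) / q := div_nonneg (by linarith) hq0.le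
  have hsub : Icc 0 θ ⊆ Icc (0 : ℝ) 1 := Icc_subset_Icc_right hf.mem.2.le
  have hsub' : ∀ v ∈ Ioo 0 θ, v ∈ Ioo (0 : ℝ) 1 := fun v hv => ⟨hv.1, hv.2.trans hf.mem.2⟩
  have hd : ∀ x ∈ Ioo 0 θ, HasDerivAt (fun v => y v - (c * v + fluxH h v) ^ q)
      (q * ((c + h x) * (y x ^ ((q - 1) / q) -
        ((c * x + fluxH h x) ^ q) ^ ((q - 1) / q)))) x := fun x hx => by
    have hx1 := hsub' x hx
    refine ((hy.deriv x hx1).sub (hasDerivAt_speed_rpow hq hh hx1)).congr_deriv ?_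
    rw [hf.zero x ⟨hx.1, hx.2.le⟩,
      rpow_sub_one_div hq0 (linear_add_fluxH_nonneg hh hc (Ioo_subset_Icc_self hx1))]
    ring
  have hcont : ContinuousOn (fun v => y v - (c * v + fluxH h v) ^ q) (Icc 0 θ) :=
    (hy.cont.sub (continuousOn_speed_rpow hq hh)).mono hsub
  have hK : ∀ x ∈ Ioo 0 θ, 0 ≤ (c * x + fluxH h x) ^ q := fun x hx =>
    Real.rpow_nonneg (linear_add_fluxH_nonneg hh hc (Ioo_subset_Icc_self (hsub' x hx))) _
  have hb : ∀ x ∈ Ioo 0 θ, 0 ≤ q * (c + h x) := fun x hx =>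
    mul_nonneg hq0.le (by linarith [hMin_le hh (Ioo_subset_Icc_self (hsub' x hx))])
  have h1 := le_of_backward le_rfl hcont hd (by simp [hθ]) (fun x hx hpos => by
    have := Real.rpow_le_rpow (hK x hx) (sub_nonneg.1 hpos.le) hr
    have := mul_nonneg (hb x hx) (sub_nonneg.2 this)
    linarith) hv
  have h2 := le_of_backward le_rfl hcont.neg (fun x hx => (hd x hx).neg) (by simp [hθ])
    (fun x hx hpos => by
    have hx0 := hy.nonneg x (Ioo_subset_Icc_self (hsub' x hx))
    have hle : y x ≤ (c * x + fluxH h x) ^ q := by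
      simp only [Pi.neg_apply, neg_sub] at hpos; linarith
    have := Real.rpow_le_rpow hx0 hle hr
    have := mul_nonneg (hb x hx) (sub_nonneg.2 this)
    linarith) hv
  simp only [Pi.neg_apply] at h2
  linarith

/-- `W` is the profile, as a function of the density, of minus the flux of a wave of speed `c`. -/
structure IsProfile (q : ℝ) (h f : ℝ → ℝ) (c : ℝ) (W : ℝ → ℝ) : Prop where
  cont : ContinuousOn W (Icc 0 1)
  zero : W 0 = 0
  one : W 1 = 0
  pos : ∀ v ∈ Ioo (0 : ℝ) 1, 0 < W v
  deriv : ∀ v ∈ Ioo (0 : ℝ) 1, HasDerivAt W (c + h v - f v / W v ^ (q - 1)) v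

lemma PhaseSol.isProfile {q θ c : ℝ} {h f y : ℝ → ℝ} (hy : PhaseSol q h f c y)
    (hq : 1 < q) (hh : ContinuousOn h (Icc 0 1)) (hf : IsReaction θ f) (hc : -hMin h < c)
    (hθ : y θ = (c * θ + fluxH h θ) ^ q) : IsProfile q h f c (fun v => y v ^ (1 / q)) := by
  have hq0 : 0 < q := by linarith
  have hpos : ∀ v ∈ Ioo (0 : ℝ) 1, 0 < y v := by
    intro v hv
    rcases le_or_gt v θ with h1 | h1
    · rw [hy.eq_speed_rpow hq hh hf hc.le hθ ⟨hv.1.le, h1⟩]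
      exact Real.rpow_pos_of_pos (linear_add_fluxH_pos hh hc (Ioo_subset_Ioc_self hv)) _
    · exact hy.pos hq hf ⟨h1, hv.2⟩
  have h1q : 1 / q ≠ 0 := by positivity
  refine ⟨hy.continuousOn_root hq, ?_, ?_, fun v hv => Real.rpow_pos_of_pos (hpos v hv) _,
    fun v hv => hy.hasDerivAt_root hq hv (hpos v hv)⟩
  · rw [hy.eq_speed_rpow hq hh hf hc.le hθ (left_mem_Icc.2 hf.mem.1.le), linear_add_fluxH_zero,
      Real.zero_rpow hq0.ne', Real.zero_rpow h1q]
  · rw [hy.terminal, Real.zero_rpow h1q]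

theorem exists_isProfile {q θ : ℝ} {h f : ℝ → ℝ} (hq : 1 < q) (hh : ContinuousOn h (Icc 0 1))
    (hf : IsReaction θ f)
    (hlt : (fluxH h 1 - hMin h) ^ q < q * ∫ v in (0 : ℝ)..1, f v) :
    ∃ c W, -hMin h < c ∧ IsProfile q h f c W ∧
      (c * θ + fluxH h θ) ^ q < q * ∫ v in (0 : ℝ)..1, f v := by
  have hq0 : 0 < q := by linarith
  have hθ0 := hf.mem.1
  have hθ : θ ∈ Icc (0 : ℝ) 1 := Ioo_subset_Icc_self hf.mem
  obtain ⟨y, hy, hyc⟩ := exists_phaseSol hq hh hf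
  set m := hMin h
  set I := ∫ v in (0 : ℝ)..1, f v
  have hI : 0 < q * I := mul_pos hq0 hf.integral_pos
  -- At this speed `K(θ) ≥ (q I)^(1/q)`, which `y_c(θ)^(1/q)` cannot exceed.
  set c₁ := max (-m) (((q * I) ^ (1 / q) - fluxH h θ) / θ)
  have hc₁ : -m ≤ c₁ := le_max_left _ _
  have hcont : ContinuousOn (fun c => y c θ - (c * θ + fluxH h θ) ^ q) (Icc (-m) c₁) := by
    refine ((hyc θ hθ).mono Icc_subset_Ici_self).sub ?_
    exact ContinuousOn.rpow_const (by fun_prop) fun _ _ => Or.inr hq0.le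
  have hlow : 0 < y (-m) θ - (-m * θ + fluxH h θ) ^ q := by
    by_contra hle
    have := (hy (-m) le_rfl).integral_le_of_le hq hh hf le_rfl (by linarith)
    rw [mul_one, neg_add_eq_sub] at this
    exact absurd hlt (not_lt.2 this)
  have hhigh : y c₁ θ - (c₁ * θ + fluxH h θ) ^ q ≤ 0 := by
    have h1 := (hy c₁ hc₁).le_integral hq hh hf hc₁
    have h2 : (q * I) ^ (1 / q) ≤ c₁ * θ + fluxH h θ := by
      have := (div_le_iff₀ hθ0).1 (le_max_right (-m) (((q * I) ^ (1 / q) - fluxH h θ) / θ))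
      linarith
    have h3 := Real.rpow_le_rpow (Real.rpow_nonneg hI.le _) h2 hq0.le
    rw [← Real.rpow_mul hI.le, one_div_mul_cancel hq0.ne', Real.rpow_one] at h3
    linarith
  -- The crossing lies strictly to the right of `-m`, as positivity of the profile and the strict
  -- bound require.
  obtain ⟨c, hc, hc0, -⟩ := exists_first_nonpos hc₁ hcont hlow hhigh
  have hcθ : y c θ = (c * θ + fluxH h θ) ^ q := sub_eq_zero.1 hc0
  exact ⟨c, _, hc.1, (hy c hc.1.le).isProfile hq hh hf hc.1 hcθ,
    hcθ ▸ (hy c hc.1.le).lt_integral hq hh hf hc.1⟩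

/-! ### Uniqueness of the profile -/

lemma IsProfile.eq_linear_add_fluxH {q θ c : ℝ} {h f W : ℝ → ℝ} (hW : IsProfile q h f c W)
    (hh : ContinuousOn h (Icc 0 1)) (hf : IsReaction θ f) {v : ℝ} (hv : v ∈ Icc 0 θ) :
    W v = c * v + fluxH h v := by
  have hsub : Icc 0 θ ⊆ Icc (0 : ℝ) 1 := Icc_subset_Icc_right hf.mem.2.le
  have hd : ∀ x ∈ interior (Icc 0 θ), HasDerivWithinAt (fun v => W v - (c * v + fluxH h v)) 0
      (interior (Icc 0 θ)) x := fun x hx => by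
    rw [interior_Icc] at hx
    have hx1 : x ∈ Ioo (0 : ℝ) 1 := ⟨hx.1, hx.2.trans hf.mem.2⟩
    refine (((hW.deriv x hx1).sub (hasDerivAt_linear_add_fluxH hh c hx1)).congr_deriv
      ?_).hasDerivWithinAt
    rw [hf.zero x ⟨hx.1, hx.2.le⟩]; ring
  have hcont : ContinuousOn (fun v => W v - (c * v + fluxH h v)) (Icc 0 θ) :=
    (hW.cont.sub (continuousOn_linear_add_fluxH hh c)).mono hsub
  have h1 := monotoneOn_of_hasDerivWithinAt_nonneg (convex_Icc 0 θ) hcont hd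
    (fun _ _ => le_rfl) (left_mem_Icc.2 hf.mem.1.le) hv hv.1
  have h2 := antitoneOn_of_hasDerivWithinAt_nonpos (convex_Icc 0 θ) hcont hd
    (fun _ _ => le_rfl) (left_mem_Icc.2 hf.mem.1.le) hv hv.1
  simp only [hW.zero, linear_add_fluxH_zero] at h1 h2
  linarith

lemma div_rpow_anti {q a x y : ℝ} (hq : 1 < q) (ha : 0 ≤ a) (hx : 0 < x) (hxy : x ≤ y) :
    a / y ^ (q - 1) ≤ a / x ^ (q - 1) :=
  div_le_div_of_nonneg_left ha (Real.rpow_pos_of_pos hx _)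
    (Real.rpow_le_rpow hx.le hxy (by linarith))

/-- If `c < c'`, then `W - W' = -(c' - c) θ` at `θ`. Whenever `W - W'` touches this negative level
again, `W ≤ W'` makes its derivative negative, so it remains below it up to `1`, where both profiles
vanish. -/
lemma IsProfile.speed_le {q θ c c' : ℝ} {h f W W' : ℝ → ℝ} (hW : IsProfile q h f c W)
    (hW' : IsProfile q h f c' W') (hq : 1 < q) (hh : ContinuousOn h (Icc 0 1))
    (hf : IsReaction θ f) : c' ≤ c := by
  by_contra! hlt
  have hθ0 := hf.mem.1
  have hsub : Icc θ 1 ⊆ Icc (0 : ℝ) 1 := Icc_subset_Icc_left hf.mem.1.le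
  have hθv : W' θ - W θ = (c' - c) * θ := by
    rw [hW.eq_linear_add_fluxH hh hf (right_mem_Icc.2 hθ0.le),
      hW'.eq_linear_add_fluxH hh hf (right_mem_Icc.2 hθ0.le)]
    ring
  have hpos : 0 < (c' - c) * θ := mul_pos (by linarith) hθ0
  have key := image_le_of_deriv_right_lt_deriv_boundary (a := θ) (b := 1)
    (f := fun v => W v - W' v) (B := fun _ => -((c' - c) * θ)) (B' := fun _ => 0)
    (f' := fun v => (c + h v - f v / W v ^ (q - 1)) - (c' + h v - f v / W' v ^ (q - 1)))
    ((hW.cont.sub hW'.cont).mono hsub)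
    (fun x hx => ((hW.deriv x ⟨hθ0.trans_le hx.1, hx.2⟩).sub
      (hW'.deriv x ⟨hθ0.trans_le hx.1, hx.2⟩)).hasDerivWithinAt)
    (by linarith) (fun x => hasDerivAt_const x _) (fun x hx heq => ?_)
    (right_mem_Icc.2 hf.mem.2.le)
  · simp only [hW.one, hW'.one] at key
    linarith
  · have hx1 : x ∈ Ioo (0 : ℝ) 1 := ⟨hθ0.trans_le hx.1, hx.2⟩
    have := div_rpow_anti hq (hf.nonneg hx1) (hW.pos x hx1)
      (show W x ≤ W' x by linarith)
    linarith

/-- The term `-f / W^(q-1)` is nondecreasing in `W`, so the squared difference can only grow towards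
`1`, where it is zero. -/
lemma IsProfile.eqOn {q θ c : ℝ} {h f W W' : ℝ → ℝ} (hW : IsProfile q h f c W)
    (hW' : IsProfile q h f c W') (hq : 1 < q) (hf : IsReaction θ f) : EqOn W W' (Icc 0 1) := by
  intro v hv
  have hmono : MonotoneOn (fun v => (W v - W' v) ^ 2) (Icc 0 1) := by
    refine monotoneOn_of_hasDerivWithinAt_nonneg (convex_Icc 0 1)
      ((hW.cont.sub hW'.cont).pow 2) (fun x hx => by
        rw [interior_Icc] at hx
        exact (((hW.deriv x hx).sub (hW'.deriv x hx)).pow 2).hasDerivWithinAt) (fun x hx => ?_)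
    rw [interior_Icc] at hx
    simp only [Nat.cast_ofNat, Nat.add_one_sub_one, pow_one, Pi.sub_apply]
    rcases le_total (W x) (W' x) with hle | hle
    · have := div_rpow_anti hq (hf.nonneg hx) (hW.pos x hx) hle
      nlinarith
    · have := div_rpow_anti hq (hf.nonneg hx) (hW'.pos x hx) hle
      nlinarith
  have h1 := hmono hv (right_mem_Icc.2 zero_le_one) hv.2
  simp only [hW.one, hW'.one, sub_self] at h1
  have : (W v - W' v) ^ 2 = 0 := le_antisymm (by simpa using h1) (sq_nonneg _)
  exact sub_eq_zero.1 (pow_eq_zero_iff two_ne_zero |>.1 this)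

/-! ### From profiles to solutions -/

lemma exists_decreasing_inverse {X : ℝ → ℝ} (hX : StrictAntiOn X (Ioo 0 1))
    (hXc : ContinuousOn X (Ioo 0 1)) : ∃ u : ℝ → ℝ, Continuous u ∧ (∀ ξ, u ξ ∈ Icc (0 : ℝ) 1) ∧
      (∀ ξ ∈ interiorSet u, X (u ξ) = ξ) ∧ Tendsto u atBot (𝓝 1) ∧ Tendsto u atTop (𝓝 0) := by
  -- A generalized inverse: it takes the value `0` or `1` beyond the range of `X`, so it covers
  -- waves that reach an end state at a finite point as well as those that do not. The inserted `0`
  -- keeps the supremum meaningful when no `v` qualifies.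
  set S : ℝ → Set ℝ := fun ξ => insert 0 {v | v ∈ Ioo (0 : ℝ) 1 ∧ ξ ≤ X v} with hS
  set u : ℝ → ℝ := fun ξ => sSup (S ξ) with hu
  have hS1 : ∀ ξ, ∀ v ∈ S ξ, v ≤ 1 := by
    rintro ξ v (rfl | hv)
    · exact zero_le_one
    · exact hv.1.2.le
  have hbdd : ∀ ξ, BddAbove (S ξ) := fun ξ => ⟨1, hS1 ξ⟩
  have hne : ∀ ξ, (S ξ).Nonempty := fun ξ => ⟨0, mem_insert _ _⟩
  have hmem : ∀ ξ, u ξ ∈ Icc (0 : ℝ) 1 := fun ξ =>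
    ⟨le_csSup (hbdd ξ) (mem_insert _ _), csSup_le (hne ξ) (hS1 ξ)⟩
  have hge : ∀ v ∈ Ioo (0 : ℝ) 1, ∀ ξ, ξ ≤ X v → v ≤ u ξ := fun v hv ξ h =>
    le_csSup (hbdd ξ) (Or.inr ⟨hv, h⟩)
  have hle : ∀ v ∈ Ioo (0 : ℝ) 1, ∀ ξ, X v ≤ ξ → u ξ ≤ v := by
    intro v hv ξ h
    refine csSup_le (hne ξ) ?_
    rintro w (rfl | hw)
    · exact hv.1.le
    · exact (hX.le_iff_ge hv hw.1).1 (h.trans hw.2)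
  have hanti : Antitone u := by
    intro ξ η h
    refine csSup_le_csSup (hbdd ξ) (hne η) (insert_subset_insert fun v hv => ⟨hv.1, h.trans hv.2⟩)
  have huX : ∀ v ∈ Ioo (0 : ℝ) 1, u (X v) = v := fun v hv =>
    le_antisymm (hle v hv _ le_rfl) (hge v hv _ le_rfl)
  have hcont : Continuous u := by
    -- Reflection gives a monotone map into `[0, 1]`; since its range contains `(0, 1)` it is dense,
    -- and this forces continuity.
    set U : ℝ → Icc (0 : ℝ) 1 := fun ξ => ⟨u (-ξ), hmem _⟩
    have hU : Monotone U := fun ξ η h => hanti (neg_le_neg h)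
    have hd : DenseRange U := by
      have hsub : (Subtype.val ⁻¹' Ioo (0 : ℝ) 1 : Set (Icc (0 : ℝ) 1)) ⊆ range U := by
        intro v hv
        exact ⟨-X v, Subtype.ext (by simpa [U] using huX v hv)⟩
      refine Dense.mono hsub fun v => ?_
      rw [closure_subtype, Subtype.image_preimage_coe, inter_eq_right.2 Ioo_subset_Icc_self,
        closure_Ioo zero_ne_one]
      exact v.2
    have := (continuous_subtype_val.comp (hU.continuous_of_denseRange hd)).comp continuous_neg
    simpa [Function.comp_def, U] using this
  refine ⟨u, hcont, hmem, fun ξ hξ => ?_, tendsto_order.2 ⟨fun a ha => ?_, fun a ha => ?_⟩,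
    tendsto_order.2 ⟨fun a ha => ?_, fun a ha => ?_⟩⟩
  · have hv : u ξ ∈ Ioo (0 : ℝ) 1 := hξ
    have hXat : ContinuousAt X (u ξ) := hXc.continuousAt (Ioo_mem_nhds hv.1 hv.2)
    refine le_antisymm ?_ ?_
    · by_contra! hlt
      have h1 : ∀ᶠ v in 𝓝[>] (u ξ), ξ < X v ∧ v ∈ Ioo (0 : ℝ) 1 ∧ u ξ < v := by
        filter_upwards [nhdsWithin_le_nhds (hXat.eventually (lt_mem_nhds hlt)),
          nhdsWithin_le_nhds (Ioo_mem_nhds hv.1 hv.2), self_mem_nhdsWithin] with v h2 h3 h4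
        exact ⟨h2, h3, h4⟩
      obtain ⟨v, h2, h3, h4⟩ := h1.exists
      exact absurd (hge v h3 ξ h2.le) (not_le.2 h4)
    · by_contra! hlt
      have h1 : ∀ᶠ v in 𝓝[<] (u ξ), X v < ξ ∧ v ∈ Ioo (0 : ℝ) 1 ∧ v < u ξ := by
        filter_upwards [nhdsWithin_le_nhds (hXat.eventually (gt_mem_nhds hlt)),
          nhdsWithin_le_nhds (Ioo_mem_nhds hv.1 hv.2), self_mem_nhdsWithin] with v h2 h3 h4
        exact ⟨h2, h3, h4⟩
      obtain ⟨v, h2, h3, h4⟩ := h1.exists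
      exact absurd (hle v h3 ξ h2.le) (not_le.2 h4)
  · obtain ⟨v, h1, h2⟩ := exists_between (max_lt ha zero_lt_one)
    have hv : v ∈ Ioo (0 : ℝ) 1 := ⟨(le_max_right _ _).trans_lt h1, h2⟩
    filter_upwards [eventually_le_atBot (X v)] with ξ hξ
    exact ((le_max_left _ _).trans_lt h1).trans_le (hge v hv ξ hξ)
  · exact Eventually.of_forall fun ξ => (hmem ξ).2.trans_lt ha
  · exact Eventually.of_forall fun ξ => ha.trans_le (hmem ξ).1
  · obtain ⟨v, h1, h2⟩ := exists_between (lt_min ha zero_lt_one)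
    have hv : v ∈ Ioo (0 : ℝ) 1 := ⟨h1, h2.trans_le (min_le_right _ _)⟩
    filter_upwards [eventually_ge_atTop (X v)] with ξ hξ
    exact (hle v hv ξ hξ).trans_lt (h2.trans_le (min_le_left _ _))

lemma conjExponent_sub_one_mul {p : ℝ} (hp : 1 < p) : (Real.conjExponent p - 1) * (p - 1) = 1 := by
  have : p - 1 ≠ 0 := by linarith
  rw [Real.conjExponent]; field_simp; ring

lemma one_lt_conjExponent {p : ℝ} (hp : 1 < p) : 1 < Real.conjExponent p := by
  rw [Real.conjExponent, lt_div_iff₀ (by linarith)]; linarith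

lemma abs_rpow_mul_self_of_neg {p a : ℝ} (ha : a < 0) :
    |a| ^ (p - 2) * a = -(-a) ^ (p - 1) := by
  have h0 : 0 < -a := neg_pos.2 ha
  rw [abs_of_neg ha, show p - 1 = (p - 2) + 1 by ring, Real.rpow_add_one h0.ne']
  ring

lemma isOpen_interiorSet {u : ℝ → ℝ} (hu : Continuous u) : IsOpen (interiorSet u) :=
  (isOpen_lt continuous_const hu).inter (isOpen_lt hu continuous_const)

lemma eq_zero_or_one_of_notMem {u : ℝ → ℝ} {ξ : ℝ} (h : u ξ ∈ Icc (0 : ℝ) 1)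
    (hξ : ξ ∉ interiorSet u) : u ξ = 0 ∨ u ξ = 1 := by
  by_contra! hne
  exact hξ ⟨lt_of_le_of_ne h.1 (Ne.symm hne.1), lt_of_le_of_ne h.2 hne.2⟩

theorem IsProfile.exists_isSolution {p c : ℝ} {D h g W : ℝ → ℝ} (hp : 1 < p)
    (hD : ContinuousOn D (Ioo 0 1)) (hDpos : ∀ v ∈ Ioo (0 : ℝ) 1, 0 < D v)
    (hW : IsProfile (Real.conjExponent p) h (weight p D g) c W) :
    ∃ u, IsSolution p D h g c u := by
  set q := Real.conjExponent p
  have hWD : ∀ v ∈ Ioo (0 : ℝ) 1, 0 < W v / D v := fun v hv => div_pos (hW.pos v hv) (hDpos v hv)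
  -- `A(u)` is the intended slope `|u'|`, from `D |u'|^(p-1) = W` and `(q - 1)(p - 1) = 1`.
  set A : ℝ → ℝ := fun v => (W v / D v) ^ (q - 1) with hA
  have hApos : ∀ v ∈ Ioo (0 : ℝ) 1, 0 < A v := fun v hv => Real.rpow_pos_of_pos (hWD v hv) _
  have hAc : ContinuousOn A (Ioo 0 1) :=
    ((hW.cont.mono Ioo_subset_Icc_self).div hD fun v hv => (hDpos v hv).ne').rpow_const
      fun v hv => Or.inl (hWD v hv).ne'
  have hAic : ContinuousOn (fun v => -(A v)⁻¹) (Ioo 0 1) :=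
    (hAc.inv₀ fun v hv => (hApos v hv).ne').neg
  set X : ℝ → ℝ := fun v => ∫ t in (1 / 2 : ℝ)..v, -(A t)⁻¹
  have hXd : ∀ v ∈ Ioo (0 : ℝ) 1, HasDerivAt X (-(A v)⁻¹) v := fun v hv =>
    intervalIntegral.integral_hasDerivAt_right
      (ContinuousOn.intervalIntegrable
        (hAic.mono (ordConnected_Ioo.uIcc_subset (by norm_num) hv)))
      (hAic.stronglyMeasurableAtFilter isOpen_Ioo v hv)
      (hAic.continuousAt (Ioo_mem_nhds hv.1 hv.2))
  have hXc : ContinuousOn X (Ioo 0 1) := fun v hv => (hXd v hv).continuousAt.continuousWithinAt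
  have hXanti : StrictAntiOn X (Ioo 0 1) := by
    refine strictAntiOn_of_deriv_neg (convex_Ioo 0 1) hXc fun v hv => ?_
    rw [interior_Ioo] at hv
    rw [(hXd v hv).deriv]
    exact neg_neg_of_pos (inv_pos.2 (hApos v hv))
  obtain ⟨u, huc, humem, hXu, hbot, htop⟩ := exists_decreasing_inverse hXanti hXc
  have hopen := isOpen_interiorSet huc
  have hud : ∀ ξ ∈ interiorSet u, HasDerivAt u (-A (u ξ)) ξ := by
    intro ξ hξ
    have h1 := HasDerivAt.of_local_left_inverse huc.continuousAt (hXd (u ξ) hξ)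
      (neg_ne_zero.2 (inv_ne_zero (hApos _ hξ).ne'))
      (by filter_upwards [hopen.mem_nhds hξ] with y hy using hXu y hy)
    exact h1.congr_deriv (by rw [inv_neg, inv_inv])
  have hflux : diffFlux p D u = fun ξ => -W (u ξ) := by
    funext ξ
    by_cases hξ : ξ ∈ interiorSet u
    · have hv : u ξ ∈ Ioo (0 : ℝ) 1 := hξ
      rw [diffFlux, if_pos hξ, (hud ξ hξ).deriv,
        abs_rpow_mul_self_of_neg (neg_neg_of_pos (hApos _ hv)), neg_neg, hA,
        ← Real.rpow_mul (hWD _ hv).le, conjExponent_sub_one_mul hp, Real.rpow_one]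
      have := (hDpos _ hv).ne'
      field_simp
    · rw [diffFlux, if_neg hξ]
      rcases eq_zero_or_one_of_notMem (humem ξ) hξ with h0 | h0 <;>
        simp [h0, hW.zero, hW.one]
  have hfd : ∀ ξ ∈ interiorSet u, HasDerivAt (diffFlux p D u)
      (-((c + h (u ξ) - weight p D g (u ξ) / W (u ξ) ^ (q - 1)) * -A (u ξ))) ξ := by
    intro ξ hξ
    rw [hflux]
    exact ((hW.deriv (u ξ) hξ).comp ξ (hud ξ hξ)).neg
  have hlim : ∀ a ∈ Icc (0 : ℝ) 1, W a = 0 →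
      Tendsto (diffFlux p D u) (comap u (𝓝 a)) (𝓝 0) := by
    intro a ha hWa
    have h1 : Tendsto u (comap u (𝓝 a)) (𝓝[Icc 0 1] a) :=
      tendsto_nhdsWithin_iff.2 ⟨tendsto_comap, Eventually.of_forall humem⟩
    have h2 := ((hW.cont a ha).tendsto.comp h1).neg
    rw [hWa, neg_zero] at h2
    rw [hflux]
    exact h2
  refine ⟨u, huc, humem, ?_, fun ξ hξ => (hfd ξ hξ).differentiableAt, fun ξ hξ => ?_, ?_,
    hlim 0 (by simp) hW.zero, hlim 1 (by simp) hW.one, hbot, htop⟩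
  · rw [show (1 : WithTop ℕ∞) = 0 + 1 by simp, contDiffOn_succ_iff_deriv_of_isOpen hopen]
    refine ⟨fun ξ hξ => (hud ξ hξ).differentiableAt.differentiableWithinAt, by simp, ?_⟩
    rw [contDiffOn_zero]
    refine ContinuousOn.congr (f := fun ξ => -A (u ξ)) ?_ fun ξ hξ => (hud ξ hξ).deriv
    exact (hAc.comp huc.continuousOn fun ξ hξ => hξ).neg
  · have hv : u ξ ∈ Ioo (0 : ℝ) 1 := hξ
    rw [(hfd ξ hξ).deriv, (hud ξ hξ).deriv]
    have h1 : weight p D g (u ξ) / W (u ξ) ^ (q - 1) * A (u ξ) = g (u ξ) := by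
      have h2 := Real.rpow_pos_of_pos (hW.pos _ hv) (q - 1)
      have h3 := Real.rpow_pos_of_pos (hDpos _ hv) (q - 1)
      simp only [hA, weight]
      rw [Real.div_rpow (hW.pos _ hv).le (hDpos _ hv).le]
      change D (u ξ) ^ (q - 1) * _ / _ * _ = _
      field_simp
    linear_combination (-1 : ℝ) * h1
  · rw [hflux]
    exact (hW.cont.comp_continuous huc humem).neg

/-! ### From solutions to profiles -/

lemma abs_rpow_mul_self_pos_iff {p a : ℝ} : 0 < |a| ^ (p - 2) * a ↔ 0 < a := by
  constructor
  · intro h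
    by_contra! ha
    exact absurd h (not_lt.2 (mul_nonpos_of_nonneg_of_nonpos
      (Real.rpow_nonneg (abs_nonneg a) _) ha))
  · intro ha
    exact mul_pos (Real.rpow_pos_of_pos (abs_pos.2 ha.ne') _) ha

section Solution

variable {p θ c : ℝ} {D h g u : ℝ → ℝ}

lemma diffFlux_of_mem {ξ : ℝ} (hξ : ξ ∈ interiorSet u) :
    diffFlux p D u ξ = D (u ξ) * (|deriv u ξ| ^ (p - 2) * deriv u ξ) := if_pos hξ

lemma diffFlux_of_notMem {ξ : ℝ} (hξ : ξ ∉ interiorSet u) : diffFlux p D u ξ = 0 := if_neg hξ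

lemma diffFlux_pos_iff (hDpos : ∀ v ∈ Ioo (0 : ℝ) 1, 0 < D v) {ξ : ℝ} (hξ : ξ ∈ interiorSet u) :
    0 < diffFlux p D u ξ ↔ 0 < deriv u ξ := by
  rw [diffFlux_of_mem hξ, mul_pos_iff_of_pos_left (hDpos _ hξ), abs_rpow_mul_self_pos_iff]

namespace IsSolution

lemma isOpen (hu : IsSolution p D h g c u) : IsOpen (interiorSet u) :=
  isOpen_interiorSet hu.continuous

lemma hasDerivAt (hu : IsSolution p D h g c u) {ξ : ℝ} (hξ : ξ ∈ interiorSet u) :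
    HasDerivAt u (deriv u ξ) ξ :=
  ((hu.contDiffOn.differentiableOn (by simp)).differentiableAt (hu.isOpen.mem_nhds hξ)).hasDerivAt

lemma hasDerivAt_diffFlux (hu : IsSolution p D h g c u) {ξ : ℝ} (hξ : ξ ∈ interiorSet u) :
    HasDerivAt (diffFlux p D u) (-((c + h (u ξ)) * deriv u ξ) - g (u ξ)) ξ :=
  (hu.flux_differentiableAt ξ hξ).hasDerivAt.congr_deriv (by linarith [hu.equation ξ hξ])

/-- The equation integrated once: flux plus `K(u)` is nonincreasing when `g ≥ 0`, and conserved
where `g(u) = 0`. The sign results for the flux rest on it. -/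
lemma hasDerivAt_total (hu : IsSolution p D h g c u) (hh : ContinuousOn h (Icc 0 1)) {ξ : ℝ}
    (hξ : ξ ∈ interiorSet u) :
    HasDerivAt (fun ξ => diffFlux p D u ξ + (c * u ξ + fluxH h (u ξ))) (-g (u ξ)) ξ :=
  ((hu.hasDerivAt_diffFlux hξ).add
    ((hasDerivAt_linear_add_fluxH hh c (v := u ξ) hξ).comp ξ (hu.hasDerivAt hξ))).congr_deriv
    (by ring)

lemma continuous_total (hu : IsSolution p D h g c u) (hh : ContinuousOn h (Icc 0 1)) :
    Continuous (fun ξ => diffFlux p D u ξ + (c * u ξ + fluxH h (u ξ))) :=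
  hu.flux_continuous.add
    ((continuousOn_linear_add_fluxH hh c).comp_continuous hu.continuous hu.mem_Icc)

/-- The flux, and hence the slope, of a wave never becomes positive. -/
lemma diffFlux_nonpos (hu : IsSolution p D h g c u) (hDpos : ∀ v ∈ Ioo (0 : ℝ) 1, 0 < D v)
    (hh : ContinuousOn h (Icc 0 1)) (hg : ∀ v ∈ Ioo (0 : ℝ) 1, 0 ≤ g v) (hc : -hMin h < c)
    {ξ₀ : ℝ} (hξ₀ : ξ₀ ∈ interiorSet u) : diffFlux p D u ξ₀ ≤ 0 := by
  by_contra! hpos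
  set K : ℝ → ℝ := fun v => c * v + fluxH h v with hK
  have hKm : StrictMonoOn K (Icc 0 1) := strictMonoOn_linear_add_fluxH hh hc
  -- The level `v₁` lies so little above `u ξ₀` that the total at `ξ₀` still exceeds `K v₁`. To the
  -- left the total is no smaller, so the flux is positive while `0 < u < v₁`.
  obtain ⟨v₁, hv₁, hKv₁, hlt⟩ : ∃ v₁, v₁ < 1 ∧ K v₁ < diffFlux p D u ξ₀ + K (u ξ₀) ∧
      u ξ₀ < v₁ := by
    have hKc : ContinuousAt K (u ξ₀) :=
      (hasDerivAt_linear_add_fluxH hh c (v := u ξ₀) hξ₀).continuousAt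
    have h1 : ∀ᶠ v in 𝓝[>] (u ξ₀), v < 1 ∧ K v < diffFlux p D u ξ₀ + K (u ξ₀) ∧ u ξ₀ < v := by
      filter_upwards [nhdsWithin_le_nhds (gt_mem_nhds hξ₀.2), self_mem_nhdsWithin,
        nhdsWithin_le_nhds (hKc.eventually (gt_mem_nhds (lt_add_of_pos_left _ hpos)))]
        with v h2 h3 h4 using ⟨h2, h4, h3⟩
    exact h1.exists
  have hv₁0 : 0 < v₁ := hξ₀.1.trans hlt
  obtain ⟨a, ha, hua⟩ : ∃ a, a ≤ ξ₀ ∧ v₁ < u a :=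
    ((eventually_le_atBot ξ₀).and (hu.tendsto_atBot.eventually (lt_mem_nhds hv₁))).exists
  obtain ⟨x, hx, hx0, hxpos⟩ := exists_last_nonpos (f := fun ξ => min (u ξ) (v₁ - u ξ)) ha
    (hu.continuous.min (continuous_const.sub hu.continuous)).continuousOn
    (min_le_of_right_le (by linarith)) (lt_min hξ₀.1 (by linarith))
  have hmem : ∀ y ∈ Ioc x ξ₀, y ∈ interiorSet u ∧ u y < v₁ := fun y hy => by
    have h1 := lt_min_iff.1 (hxpos y hy)
    exact ⟨⟨h1.1, by linarith⟩, by linarith⟩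
  have hanti : AntitoneOn (fun ξ => diffFlux p D u ξ + K (u ξ)) (Icc x ξ₀) := by
    refine antitoneOn_of_hasDerivWithinAt_nonpos (convex_Icc x ξ₀)
      (hu.continuous_total hh).continuousOn (f' := fun ξ => -g (u ξ))
      (fun y hy => ?_) (fun y hy => ?_) <;> rw [interior_Icc] at hy
    · exact (hu.hasDerivAt_total hh (hmem y (Ioo_subset_Ioc_self hy)).1).hasDerivWithinAt
    · exact neg_nonpos.2 (hg _ (hmem y (Ioo_subset_Ioc_self hy)).1)
  have hge : ∀ y ∈ Icc x ξ₀, K v₁ < diffFlux p D u y + K (u y) := fun y hy =>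
    hKv₁.trans_le (hanti hy (right_mem_Icc.2 hx.2.le) hy.2)
  have hKv₁0 : 0 < K v₁ := linear_add_fluxH_pos hh hc ⟨hv₁0, hv₁.le⟩
  have hxx := hge x (left_mem_Icc.2 hx.2.le)
  -- Since `u → 1` on the left, `u` must have left `(0, v₁)`. At `u x = 0` the total would be `0`,
  -- below `K v₁`; at `u x = v₁` the wave would have to increase from `v₁` to `u ξ₀ < v₁`.
  rcases min_choice (u x) (v₁ - u x) with hm | hm <;> rw [hm] at hx0
  · rw [diffFlux_of_notMem (fun hmx => hmx.1.ne' hx0), hx0, hK] at hxx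
    simp only [linear_add_fluxH_zero] at hxx
    linarith
  · have hmono : StrictMonoOn u (Icc x ξ₀) := by
      refine strictMonoOn_of_deriv_pos (convex_Icc x ξ₀) hu.continuous.continuousOn
        fun y hy => ?_
      rw [interior_Icc] at hy
      obtain ⟨h1, h2⟩ := hmem y (Ioo_subset_Ioc_self hy)
      refine (diffFlux_pos_iff (p := p) hDpos h1).1 ?_
      have h3 := hKm ⟨h1.1.le, h1.2.le⟩ ⟨hv₁0.le, hv₁.le⟩ h2
      linarith [hge y (Ioo_subset_Icc_self hy)]
    have := hmono (left_mem_Icc.2 hx.2.le) (right_mem_Icc.2 hx.2.le) hx.2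
    linarith

/-- A rise would contain a stretch between two intermediate levels. There `u` stays strictly inside
`(0, 1)`, so the sign of the flux makes it nonincreasing. -/
lemma antitone (hu : IsSolution p D h g c u) (hDpos : ∀ v ∈ Ioo (0 : ℝ) 1, 0 < D v)
    (hh : ContinuousOn h (Icc 0 1)) (hg : ∀ v ∈ Ioo (0 : ℝ) 1, 0 ≤ g v) (hc : -hMin h < c) :
    Antitone u := by
  intro a b hab
  by_contra! hlt
  obtain ⟨v₁, h1, h2⟩ := exists_between hlt
  obtain ⟨v₂, h3, h4⟩ := exists_between h2
  obtain ⟨x, hx, hx0, hxpos⟩ := exists_last_nonpos (f := fun ξ => u ξ - v₁) hab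
    (hu.continuous.sub continuous_const).continuousOn (by linarith) (by linarith)
  obtain ⟨y, hy, hy0, hypos⟩ := exists_first_nonpos (f := fun ξ => v₂ - u ξ) hx.2.le
    (continuous_const.sub hu.continuous).continuousOn (by linarith) (by linarith)
  have hanti : AntitoneOn u (Icc x y) := by
    refine antitoneOn_of_deriv_nonpos (convex_Icc x y) hu.continuous.continuousOn ?_ ?_ <;>
      rw [interior_Icc]
    all_goals
      intro z hz
      have hz1 := hxpos z ⟨hz.1, hz.2.le.trans hy.2⟩
      have hz2 := hypos z ⟨hz.1.le, hz.2⟩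
      have hzI : z ∈ interiorSet u :=
        ⟨by linarith [(hu.mem_Icc a).1], by linarith [(hu.mem_Icc b).2]⟩
    · exact (hu.hasDerivAt hzI).differentiableAt.differentiableWithinAt
    · by_contra! hpos
      exact absurd ((diffFlux_pos_iff (p := p) hDpos hzI).2 hpos)
        (not_lt.2 (hu.diffFlux_nonpos hDpos hh hg hc hzI))
  have := hanti (left_mem_Icc.2 hy.1.le) (right_mem_Icc.2 hy.1.le) hy.1.le
  linarith

/-- A zero of the flux is a local maximum; the equation then gives `g(u) = 0`, hence `u ≤ θ`. From
there on the total stays at least `K(u ξ₀) > 0`, yet it must be `0` where `u` reaches `0`, or tend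
to `0` at infinity. -/
lemma diffFlux_neg (hu : IsSolution p D h g c u) (hDpos : ∀ v ∈ Ioo (0 : ℝ) 1, 0 < D v)
    (hh : ContinuousOn h (Icc 0 1)) (hg0 : ∀ v ∈ Icc 0 θ, g v = 0)
    (hgpos : ∀ v ∈ Ioo θ 1, 0 < g v) (hg : ∀ v ∈ Ioo (0 : ℝ) 1, 0 ≤ g v) (hc : -hMin h < c)
    {ξ₀ : ℝ} (hξ₀ : ξ₀ ∈ interiorSet u) : diffFlux p D u ξ₀ < 0 := by
  refine lt_of_le_of_ne (hu.diffFlux_nonpos hDpos hh hg hc hξ₀) fun h0 => ?_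
  have hmax : IsLocalMax (diffFlux p D u) ξ₀ := by
    filter_upwards [hu.isOpen.mem_nhds hξ₀] with y hy
    rw [h0]; exact hu.diffFlux_nonpos hDpos hh hg hc hy
  have hd0 : deriv u ξ₀ = 0 := by
    rw [diffFlux_of_mem hξ₀] at h0
    rcases mul_eq_zero.1 h0 with h1 | h1
    · exact absurd h1 (hDpos _ hξ₀).ne'
    · by_contra hne
      exact (mul_ne_zero (Real.rpow_pos_of_pos (abs_pos.2 hne) _).ne' hne) h1
  have h1 := hmax.hasDerivAt_eq_zero (hu.hasDerivAt_diffFlux hξ₀)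
  rw [hd0, mul_zero, neg_zero, zero_sub, neg_eq_zero] at h1
  have hle : u ξ₀ ≤ θ := by
    by_contra! hlt
    exact (hgpos _ ⟨hlt, hξ₀.2⟩).ne' h1
  have hanti := hu.antitone hDpos hh hg hc
  have hK0 : 0 < c * u ξ₀ + fluxH h (u ξ₀) := linear_add_fluxH_pos hh hc ⟨hξ₀.1, hξ₀.2.le⟩
  have hmono : ∀ x, ξ₀ ≤ x → (∀ y ∈ Ioo ξ₀ x, 0 < u y) →
      diffFlux p D u ξ₀ + (c * u ξ₀ + fluxH h (u ξ₀)) ≤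
        diffFlux p D u x + (c * u x + fluxH h (u x)) := by
    intro x hx hpos
    have : MonotoneOn (fun ξ => diffFlux p D u ξ + (c * u ξ + fluxH h (u ξ))) (Icc ξ₀ x) := by
      refine monotoneOn_of_hasDerivWithinAt_nonneg (convex_Icc ξ₀ x)
        (hu.continuous_total hh).continuousOn (f' := fun ξ => -g (u ξ))
        (fun y hy => ?_) (fun y hy => ?_) <;> rw [interior_Icc] at hy
      · exact (hu.hasDerivAt_total hh
          ⟨hpos y hy, (hanti hy.1.le).trans_lt hξ₀.2⟩).hasDerivWithinAt
      · rw [hg0 _ ⟨(hpos y hy).le, (hanti hy.1.le).trans hle⟩, neg_zero]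
    exact this (left_mem_Icc.2 hx) (right_mem_Icc.2 hx) hx
  rw [h0, zero_add] at hmono
  by_cases hz : ∃ b, ξ₀ ≤ b ∧ u b ≤ 0
  · obtain ⟨b, hb, hub⟩ := hz
    obtain ⟨x, hx, hx0, hpos⟩ := exists_first_nonpos hb hu.continuous.continuousOn hξ₀.1 hub
    have h2 := hmono x hx.1.le fun y hy => hpos y (Ioo_subset_Ico_self hy)
    rw [diffFlux_of_notMem (fun hmx => hmx.1.ne' hx0), hx0, linear_add_fluxH_zero] at h2
    linarith
  · push Not at hz
    have hlim : Tendsto (fun ξ => diffFlux p D u ξ + (c * u ξ + fluxH h (u ξ))) atTop (𝓝 0) := by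
      have h3 : Tendsto (diffFlux p D u) atTop (𝓝 0) :=
        hu.flux_tendsto_zero.mono_left hu.tendsto_atTop.le_comap
      have h4 : Tendsto u atTop (𝓝[Icc 0 1] 0) :=
        tendsto_nhdsWithin_iff.2 ⟨hu.tendsto_atTop, Eventually.of_forall hu.mem_Icc⟩
      have h5 := (continuousOn_linear_add_fluxH hh c 0 (by simp)).tendsto.comp h4
      rw [linear_add_fluxH_zero] at h5
      simpa using h3.add h5
    have := ge_of_tendsto hlim (by
      filter_upwards [eventually_ge_atTop ξ₀] with x hx
      exact hmono x hx fun y hy => hz y hy.1.le)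
    linarith

lemma deriv_neg (hu : IsSolution p D h g c u) (hDpos : ∀ v ∈ Ioo (0 : ℝ) 1, 0 < D v)
    (hh : ContinuousOn h (Icc 0 1)) (hg0 : ∀ v ∈ Icc 0 θ, g v = 0)
    (hgpos : ∀ v ∈ Ioo θ 1, 0 < g v) (hg : ∀ v ∈ Ioo (0 : ℝ) 1, 0 ≤ g v) (hc : -hMin h < c)
    {ξ : ℝ} (hξ : ξ ∈ interiorSet u) : deriv u ξ < 0 := by
  have h1 := hu.diffFlux_neg hDpos hh hg0 hgpos hg hc hξ
  by_contra! hle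
  rw [diffFlux_of_mem hξ] at h1
  exact absurd h1 (not_lt.2 (mul_nonneg (hDpos _ hξ).le
    (mul_nonneg (Real.rpow_nonneg (abs_nonneg _) _) hle)))

lemma strictAntiOn (hu : IsSolution p D h g c u) (hDpos : ∀ v ∈ Ioo (0 : ℝ) 1, 0 < D v)
    (hh : ContinuousOn h (Icc 0 1)) (hg0 : ∀ v ∈ Icc 0 θ, g v = 0)
    (hgpos : ∀ v ∈ Ioo θ 1, 0 < g v) (hg : ∀ v ∈ Ioo (0 : ℝ) 1, 0 ≤ g v) (hc : -hMin h < c) :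
    StrictAntiOn u (interiorSet u) := by
  have hanti := hu.antitone hDpos hh hg hc
  have hconv : Convex ℝ (interiorSet u) := OrdConnected.convex ⟨fun x hx y hy z hz =>
    ⟨hy.1.trans_le (hanti hz.2), (hanti hz.1).trans_lt hx.2⟩⟩
  refine strictAntiOn_of_deriv_neg hconv hu.continuous.continuousOn fun ξ hξ => ?_
  exact hu.deriv_neg hDpos hh hg0 hgpos hg hc (interior_subset hξ)

/-- A wave is the inverse of a strictly decreasing function whose derivative is determined by the
profile of the flux. -/
theorem exists_isProfile (hu : IsSolution p D h g c u) (hp : 1 < p)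
    (hDpos : ∀ v ∈ Ioo (0 : ℝ) 1, 0 < D v)
    (hh : ContinuousOn h (Icc 0 1)) (hg0 : ∀ v ∈ Icc 0 θ, g v = 0)
    (hgpos : ∀ v ∈ Ioo θ 1, 0 < g v) (hg : ∀ v ∈ Ioo (0 : ℝ) 1, 0 ≤ g v) (hc : -hMin h < c) :
    ∃ W X : ℝ → ℝ, IsProfile (Real.conjExponent p) h (weight p D g) c W ∧
      (∀ v ∈ Ioo (0 : ℝ) 1, u (X v) = v ∧
        HasDerivAt X (-((W v / D v) ^ (Real.conjExponent p - 1)))⁻¹ v) ∧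
      ∀ ξ ∈ interiorSet u, X (u ξ) = ξ := by
  set q := Real.conjExponent p
  have hstrict := hu.strictAntiOn hDpos hh hg0 hgpos hg hc
  have hsurj : ∀ v ∈ Ioo (0 : ℝ) 1, ∃ ξ, u ξ = v := fun v hv =>
    mem_range_of_exists_le_of_exists_ge hu.continuous
      ((hu.tendsto_atTop.eventually (gt_mem_nhds hv.1)).exists.imp fun _ => le_of_lt)
      ((hu.tendsto_atBot.eventually (lt_mem_nhds hv.2)).exists.imp fun _ => le_of_lt)
  choose! X hX using hsurj
  have hXI : ∀ v ∈ Ioo (0 : ℝ) 1, X v ∈ interiorSet u := fun v hv => by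
    simpa [interiorSet, hX v hv] using hv
  have hXu : ∀ ξ ∈ interiorSet u, X (u ξ) = ξ := fun ξ hξ =>
    hstrict.injOn (hXI _ hξ) hξ (hX _ hξ)
  have hXanti : AntitoneOn X (Ioo 0 1) := fun v hv w hw hvw => by
    rwa [← hstrict.le_iff_ge (hXI v hv) (hXI w hw), hX v hv, hX w hw]
  -- A monotone function whose image contains a neighbourhood of its value is continuous there; the
  -- sign change turns `X` into an increasing function.
  have hXc : ∀ v ∈ Ioo (0 : ℝ) 1, ContinuousAt X v := by
    intro v hv
    have h1 : ContinuousAt (fun v => -X v) v := by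
      refine continuousAt_of_monotoneOn_of_image_mem_nhds
        (fun a ha b hb hab => neg_le_neg (hXanti ha hb hab)) (Ioo_mem_nhds hv.1 hv.2) ?_
      have h2 : {η | -η ∈ interiorSet u} ∈ 𝓝 (-X v) :=
        continuous_neg.continuousAt.preimage_mem_nhds
          (by rw [neg_neg]; exact hu.isOpen.mem_nhds (hXI v hv))
      refine mem_of_superset h2 fun η hη => ⟨u (-η), hη, ?_⟩
      simp only [hXu (-η) hη, neg_neg]
    exact h1.neg.congr (Eventually.of_forall fun w => neg_neg _)
  have hXd : ∀ v ∈ Ioo (0 : ℝ) 1, HasDerivAt X (deriv u (X v))⁻¹ v := fun v hv =>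
    HasDerivAt.of_local_left_inverse (hXc v hv) (hu.hasDerivAt (hXI v hv))
      (hu.deriv_neg hDpos hh hg0 hgpos hg hc (hXI v hv)).ne
      (by filter_upwards [Ioo_mem_nhds hv.1 hv.2] with w hw using hX w hw)
  classical
  set W : ℝ → ℝ := fun v => if v ∈ Ioo (0 : ℝ) 1 then -diffFlux p D u (X v) else 0
  have hWv : ∀ v ∈ Ioo (0 : ℝ) 1, W v = -diffFlux p D u (X v) := fun v hv => if_pos hv
  have hWpos : ∀ v ∈ Ioo (0 : ℝ) 1, 0 < W v := fun v hv => by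
    rw [hWv v hv]
    exact neg_pos.2 (hu.diffFlux_neg hDpos hh hg0 hgpos hg hc (hXI v hv))
  have hdu : ∀ v ∈ Ioo (0 : ℝ) 1, deriv u (X v) = -((W v / D v) ^ (q - 1)) := by
    intro v hv
    have hneg := hu.deriv_neg hDpos hh hg0 hgpos hg hc (hXI v hv)
    have h1 : W v / D v = (-deriv u (X v)) ^ (p - 1) := by
      rw [hWv v hv, diffFlux_of_mem (hXI v hv), abs_rpow_mul_self_of_neg hneg, hX v hv]
      have := (hDpos v hv).ne'
      field_simp
    rw [h1, ← Real.rpow_mul (neg_pos.2 hneg).le, mul_comm, conjExponent_sub_one_mul hp,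
      Real.rpow_one, neg_neg]
  have hWd : ∀ v ∈ Ioo (0 : ℝ) 1,
      HasDerivAt W (c + h v - weight p D g v / W v ^ (q - 1)) v := by
    intro v hv
    have h1 := ((hu.hasDerivAt_diffFlux (hXI v hv)).comp v (hXd v hv)).neg
    have h2 : HasDerivAt W _ v := h1.congr_of_eventuallyEq
      (by filter_upwards [Ioo_mem_nhds hv.1 hv.2] with w hw using hWv w hw)
    refine h2.congr_deriv ?_
    rw [hX v hv, hdu v hv, Real.div_rpow (hWpos v hv).le (hDpos v hv).le, weight]
    have h3 := Real.rpow_pos_of_pos (hWpos v hv) (q - 1)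
    have h4 := Real.rpow_pos_of_pos (hDpos v hv) (q - 1)
    change _ = c + h v - D v ^ (q - 1) * g v / _
    field_simp
  -- The flux limits as `u → 0` and `u → 1` become continuity of `W` at the endpoints, even when `X`
  -- is unbounded there.
  have hends : ∀ a, Tendsto (diffFlux p D u) (comap u (𝓝 a)) (𝓝 0) → Tendsto W (𝓝 a) (𝓝 0) := by
    intro a ha
    refine Tendsto.if ?_ tendsto_const_nhds
    have h1 : Tendsto X (𝓝 a ⊓ 𝓟 (Ioo 0 1)) (comap u (𝓝 a)) := by
      rw [tendsto_comap_iff]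
      refine Tendsto.congr' (f₁ := id) ?_ inf_le_left
      filter_upwards [mem_inf_of_right (mem_principal_self (Ioo (0 : ℝ) 1))] with v hv
      exact (hX v hv).symm
    have h2 := (ha.comp h1).neg
    rw [neg_zero] at h2
    exact h2
  have hW0 : W 0 = 0 := if_neg (by simp)
  have hW1 : W 1 = 0 := if_neg (by simp)
  refine ⟨W, X, ⟨fun v hv => ?_, hW0, hW1, hWpos, hWd⟩,
    fun v hv => ⟨hX v hv, hdu v hv ▸ hXd v hv⟩, hXu⟩
  refine ContinuousAt.continuousWithinAt ?_
  by_cases hvI : v ∈ Ioo (0 : ℝ) 1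
  · exact (hWd v hvI).continuousAt
  · have hv01 : v = 0 ∨ v = 1 := by
      by_contra! hne
      exact hvI ⟨lt_of_le_of_ne hv.1 (Ne.symm hne.1), lt_of_le_of_ne hv.2 hne.2⟩
    rcases hv01 with rfl | rfl
    · rw [ContinuousAt, hW0]; exact hends 0 hu.flux_tendsto_zero
    · rw [ContinuousAt, hW1]; exact hends 1 hu.flux_tendsto_one

end IsSolution

end Solution

/-! ### Uniqueness up to translation, and the bound on `k(p)` -/

lemma exists_add_const_of_hasDerivAt_eq {X Y X' : ℝ → ℝ}
    (hX : ∀ v ∈ Ioo (0 : ℝ) 1, HasDerivAt X (X' v) v)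
    (hY : ∀ v ∈ Ioo (0 : ℝ) 1, HasDerivAt Y (X' v) v) :
    ∃ a, ∀ v ∈ Ioo (0 : ℝ) 1, X v = Y v + a := by
  have hd : ∀ v ∈ Ioo (0 : ℝ) 1, HasDerivAt (fun v => X v - Y v) 0 v := fun v hv =>
    ((hX v hv).sub (hY v hv)).congr_deriv (sub_self _)
  refine ⟨X (1 / 2) - Y (1 / 2), fun v hv => ?_⟩
  have := isOpen_Ioo.is_const_of_deriv_eq_zero isPreconnected_Ioo
    (fun v hv => (hd v hv).differentiableAt.differentiableWithinAt)
    (fun v hv => (hd v hv).deriv) hv (show (1 / 2 : ℝ) ∈ Ioo (0 : ℝ) 1 by norm_num)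
  linarith

lemma eq_comp_add_of_inverse {u₁ u₂ X₁ X₂ : ℝ → ℝ} {a : ℝ} (h₁ : Antitone u₁) (h₂ : Antitone u₂)
    (hm₁ : ∀ ξ, u₁ ξ ∈ Icc (0 : ℝ) 1) (hm₂ : ∀ ξ, u₂ ξ ∈ Icc (0 : ℝ) 1)
    (hX₁ : ∀ v ∈ Ioo (0 : ℝ) 1, u₁ (X₁ v) = v) (hX₂ : ∀ v ∈ Ioo (0 : ℝ) 1, u₂ (X₂ v) = v)
    (hi₁ : ∀ ξ ∈ interiorSet u₁, X₁ (u₁ ξ) = ξ) (hi₂ : ∀ ξ ∈ interiorSet u₂, X₂ (u₂ ξ) = ξ)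
    (ha : ∀ v ∈ Ioo (0 : ℝ) 1, X₁ v = X₂ v + a) (ξ : ℝ) : u₂ ξ = u₁ (ξ + a) := by
  by_cases hξ : ξ ∈ interiorSet u₂
  · have := ha _ hξ
    rw [hi₂ ξ hξ] at this
    rw [← this, hX₁ _ hξ]
  by_cases hξ' : ξ + a ∈ interiorSet u₁
  · have := ha _ hξ'
    rw [hi₁ _ hξ', add_left_inj] at this
    have h1 := hX₂ _ hξ'
    rwa [← this] at h1
  -- Off both interior sets each wave is `0` or `1`. Comparison with the corresponding points of
  -- value `1/2` shows that they take the same one.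
  have hhalf : (1 / 2 : ℝ) ∈ Ioo (0 : ℝ) 1 := by norm_num
  have e₂ := hX₂ _ hhalf
  have e₁ := hX₁ _ hhalf
  rw [ha _ hhalf] at e₁
  rcases le_total ξ (X₂ (1 / 2)) with hle | hle
  · have h3 := h₂ hle
    have h4 := h₁ (add_le_add_left hle a)
    rw [e₂] at h3
    rw [e₁] at h4
    rcases eq_zero_or_one_of_notMem (hm₂ ξ) hξ with h5 | h5 <;>
    rcases eq_zero_or_one_of_notMem (hm₁ _) hξ' with h6 | h6 <;> linarith
  · have h3 := h₂ hle
    have h4 := h₁ (add_le_add_left hle a)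
    rw [e₂] at h3
    rw [e₁] at h4
    rcases eq_zero_or_one_of_notMem (hm₂ ξ) hξ with h5 | h5 <;>
    rcases eq_zero_or_one_of_notMem (hm₁ _) hξ' with h6 | h6 <;> linarith

lemma one_lt_add_div_rpow {q t : ℝ} (hq1 : 1 < q) (hq2 : q < 2) (ht : 0 < t) :
    1 < q - 1 + (1 + q * t + t ^ q) / (1 + t) ^ q := by
  have h1 : (1 + t) ^ q ≤ 2 ^ (q - 1) * (1 ^ q + t ^ q) := by
    lift t to NNReal using ht.le
    exact_mod_cast NNReal.rpow_add_le_mul_rpow_add_rpow 1 t hq1.le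
  -- The convexity bound `h1` costs a factor `2^(q-1)`; this inequality absorbs it, using `log 2 ≤
  -- 1`.
  have h2 : 2 - q ≤ (2 : ℝ) ^ (1 - q) := by
    rw [Real.rpow_def_of_pos two_pos]
    have h3 := Real.add_one_le_exp (Real.log 2 * (1 - q))
    have h4 : Real.log 2 ≤ 1 := by linarith [Real.log_two_lt_d9]
    nlinarith
  have h5 : (0 : ℝ) < 2 ^ (q - 1) := by positivity
  have h6 : (2 : ℝ) ^ (1 - q) * 2 ^ (q - 1) = 1 := by
    rw [← Real.rpow_add two_pos]; simp
  have h7 : 0 < (1 + t) ^ q := by positivity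
  have h8 : 0 < t ^ q := by positivity
  have h9 : (2 - q) * (1 + t) ^ q < 1 + q * t + t ^ q :=
    calc (2 - q) * (1 + t) ^ q ≤ 2 ^ (1 - q) * (2 ^ (q - 1) * (1 ^ q + t ^ q)) := by gcongr
      _ = 1 + t ^ q := by rw [← mul_assoc, h6, one_mul, Real.one_rpow]
      _ < 1 + q * t + t ^ q := by nlinarith
  have := (lt_div_iff₀ h7).2 h9
  linarith

/-- This bound is all that the argument needs of `k(p)`: it turns the hypothesis on `H(1)` into the
strict inequality with constant `p'` that starts the shooting. -/
lemma kConst_nonneg_lt {p : ℝ} (hp : 1 < p) :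
    0 ≤ kConst p ∧ kConst p < Real.conjExponent p := by
  have hq := one_lt_conjExponent hp
  have hmul := conjExponent_sub_one_mul hp
  set q := Real.conjExponent p with hqdef
  unfold kConst
  rw [← hqdef]
  rcases lt_trichotomy p 2 with h2 | h2 | h2
  · rw [if_pos h2]
    have hq2 : 1 < q - 1 := by nlinarith
    have h3 : (2 : ℝ) < 2 ^ (q - 1) := by
      simpa using Real.rpow_lt_rpow_of_exponent_lt one_lt_two hq2
    refine ⟨by rw [one_div, inv_nonneg]; linarith, ?_⟩
    rw [div_lt_iff₀ (by linarith)]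
    nlinarith
  · rw [if_neg (by linarith), if_pos h2]
    exact ⟨zero_le_one, hq⟩
  · rw [if_neg (by linarith), if_neg h2.ne']
    have hq2 : q < 2 := by nlinarith
    have ht : 0 < (q - 1) ^ (1 / (q - 2)) := Real.rpow_pos_of_pos (by linarith) _
    have hpow : (q - 1) ^ (q / (q - 2)) = ((q - 1) ^ (1 / (q - 2))) ^ q := by
      rw [← Real.rpow_mul (by linarith)]; congr 1; ring
    rw [hpow]
    have := one_lt_add_div_rpow hq hq2 ht
    exact ⟨div_nonneg (by linarith) (by linarith), div_lt_self (by linarith) this⟩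

lemma isReaction_weight {p θ : ℝ} {D g : ℝ → ℝ} (hθ : θ ∈ Ioo (0 : ℝ) 1)
    (hD : ContinuousOn D (Ioo 0 1)) (hDpos : ∀ v ∈ Ioo (0 : ℝ) 1, 0 < D v)
    (hg : ContinuousOn g (Icc 0 1)) (hg0 : ∀ v ∈ Icc 0 θ, g v = 0)
    (hgpos : ∀ v ∈ Ioo θ 1, 0 < g v) (hint : IntegrableOn (weight p D g) (Ioo 0 1)) :
    IsReaction θ (weight p D g) where
  mem := hθ
  cont := (hD.rpow_const fun v hv => Or.inl (hDpos v hv).ne').mul (hg.mono Ioo_subset_Icc_self)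
  zero v hv := by rw [weight, hg0 v (Ioc_subset_Icc_self hv), mul_zero]
  pos v hv := mul_pos (Real.rpow_pos_of_pos (hDpos v ⟨hθ.1.trans hv.1, hv.2⟩) _) (hgpos v hv)
  integrable := by
    rwa [intervalIntegrable_iff_integrableOn_Ioo_of_le zero_le_one]

end CombustionWave

theorem theorem2 (p θ : ℝ) (D h g : ℝ → ℝ)
    (hp : 1 < p) (hθ : θ ∈ Ioo (0 : ℝ) 1)
    (hD : ContDiffOn ℝ 1 D (Ioo 0 1)) (hDpos : ∀ v ∈ Ioo (0 : ℝ) 1, 0 < D v)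
    (hh : ContinuousOn h (Icc 0 1))
    (hg : ContinuousOn g (Icc 0 1)) (hg0 : ∀ v ∈ Icc 0 θ, g v = 0)
    (hgpos : ∀ v ∈ Ioo θ 1, 0 < g v) (hg1 : g 1 = 0)
    (hint : IntegrableOn (weight p D g) (Ioo 0 1))
    (hex : fluxH h 1 ≤
      hMin h + (kConst p * ∫ v in (0 : ℝ)..1, weight p D g v) ^ (1 / Real.conjExponent p)) :
    ∃ c : ℝ, -hMin h < c ∧
      (∃ u : ℝ → ℝ, IsSolution p D h g c u) ∧
      (∀ c' : ℝ, -hMin h < c' → (∃ u : ℝ → ℝ, IsSolution p D h g c' u) → c' = c) ∧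
      (∀ u₁ u₂ : ℝ → ℝ, IsSolution p D h g c u₁ → IsSolution p D h g c u₂ →
        ∃ a : ℝ, ∀ ξ : ℝ, u₂ ξ = u₁ (ξ + a)) ∧
      (∀ u : ℝ → ℝ, IsSolution p D h g c u → StrictAntiOn u (interiorSet u)) ∧
      c < 1 / θ *
        ((Real.conjExponent p * ∫ v in (0 : ℝ)..1, weight p D g v) ^ (1 / Real.conjExponent p) - fluxH h θ) := by
  have hq := one_lt_conjExponent hp
  have hf := isReaction_weight (p := p) hθ hD.continuousOn hDpos hg hg0 hgpos hint
  have hg' : ∀ v ∈ Ioo (0 : ℝ) 1, 0 ≤ g v := fun v hv => by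
    rcases le_or_gt v θ with h1 | h1
    · exact (hg0 v ⟨hv.1.le, h1⟩).ge
    · exact (hgpos v ⟨h1, hv.2⟩).le
  have hI := hf.integral_pos
  obtain ⟨hk0, hk⟩ := kConst_nonneg_lt hp
  set q := Real.conjExponent p
  set I := ∫ v in (0 : ℝ)..1, weight p D g v
  have hq0 : 0 < q := by linarith
  have hkI : 0 ≤ kConst p * I := mul_nonneg hk0 hI.le
  have hlt : (fluxH h 1 - hMin h) ^ q < q * I := by
    have h0 : 0 ≤ fluxH h 1 - hMin h := by
      have := linear_add_fluxH_nonneg hh le_rfl (right_mem_Icc.2 zero_le_one)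
      linarith
    have h1 := Real.rpow_le_rpow h0
      (show fluxH h 1 - hMin h ≤ (kConst p * I) ^ (1 / q) by linarith) hq0.le
    rw [← Real.rpow_mul hkI, one_div_mul_cancel hq0.ne', Real.rpow_one] at h1
    exact h1.trans_lt (mul_lt_mul_of_pos_right hk hI)
  obtain ⟨c, W, hc, hW, hcθ⟩ := exists_isProfile hq hh hf hlt
  refine ⟨c, hc, hW.exists_isSolution hp hD.continuousOn hDpos, ?_, ?_, ?_, ?_⟩
  · rintro c' hc' ⟨u, hu⟩
    obtain ⟨W', -, hW', -⟩ := hu.exists_isProfile hp hDpos hh hg0 hgpos hg' hc'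
    exact le_antisymm (hW.speed_le hW' hq hh hf) (hW'.speed_le hW hq hh hf)
  · intro u₁ u₂ hu₁ hu₂
    obtain ⟨W₁, X₁, hW₁, hX₁, hi₁⟩ := hu₁.exists_isProfile hp hDpos hh hg0 hgpos hg' hc
    obtain ⟨W₂, X₂, hW₂, hX₂, hi₂⟩ := hu₂.exists_isProfile hp hDpos hh hg0 hgpos hg' hc
    obtain ⟨a, ha⟩ := exists_add_const_of_hasDerivAt_eq (fun v hv => (hX₁ v hv).2)
      (fun v hv => by
        rw [hW₁.eqOn hW₂ hq hf (Ioo_subset_Icc_self hv)]; exact (hX₂ v hv).2)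
    exact ⟨a, eq_comp_add_of_inverse (hu₁.antitone hDpos hh hg' hc)
      (hu₂.antitone hDpos hh hg' hc) hu₁.mem_Icc hu₂.mem_Icc (fun v hv => (hX₁ v hv).1)
      (fun v hv => (hX₂ v hv).1) hi₁ hi₂ ha⟩
  · exact fun u hu => hu.strictAntiOn hDpos hh hg0 hgpos hg' hc
  · have h0 : 0 ≤ c * θ + fluxH h θ :=
      linear_add_fluxH_nonneg hh hc.le (Ioo_subset_Icc_self hθ)
    -- Taking the `q`-th root of `K(θ)^q < q I` and dividing by `θ` gives the speed bound.
    have h1 := Real.rpow_lt_rpow (Real.rpow_nonneg h0 q) hcθ (by positivity : 0 < 1 / q)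
    rw [← Real.rpow_mul h0, mul_one_div_cancel hq0.ne', Real.rpow_one] at h1
    rw [one_div_mul_eq_div, lt_div_iff₀ hθ.1]
    linarith
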